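/- Let $d\ge 1$, $\alpha\in[-1/2,\infty)^d$ and $\varepsilon\in\{0,1\}^d$; put $\mathbb R^d_+=(0,\infty)^d$ and $|\alpha|=\alpha_1+\dots+\alpha_d$. Let $w_\alpha^+$ be the measure on $\mathbb R^d_+$ with density $\prod_{j=1}^d x_j^{2\alpha_j+1}$ with respect to Lebesgue measure, and let $B(x,r)=\{z\in\mathbb R^d_+:|z-x|<r\}$. For $t>0$ and $x,y\in\mathbb R^d_+$ let $$G_t^{\alpha,\varepsilon}(x,y)=(2\sinh 2t)^{-d}\exp\Big(-\tfrac12\coth(2t)\big(|x|^2+|y|^2\big)\Big)\prod_{i=1}^d (x_iy_i)^{\varepsilon_i}\,\frac{I_{\alpha_i+\varepsilon_i}\big(\frac{x_iy_i}{\sinh 2t}\big)}{(x_iy_i)^{\alpha_i+\varepsilon_i}},$$ where $I_\nu$ is the modified Bessel function of the first kind of order $\nu$. (a) There is a constant $C$, depending only on $d,\alpha,\varepsilon$, such that for every bounded measurable function $\eta:(0,\infty)\to\mathbb C$, every $M\ge\sup_{t>0}|\eta(t)|$ and all $x,y\in\mathbb R^d_+$ with $x\ne y$, the integral $$K^{\alpha,\varepsilon}(x,y)=-\int_0^\infty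 \partial_tG_t^{\alpha,\varepsilon}(x,y)\,\eta(t)\,dt$$ converges absolutely, $K^{\alpha,\varepsilon}$ is differentiable at $(x,y)$ (in the real sense, as a function of $2d$ real variables), and $$|K^{\alpha,\varepsilon}(x,y)|\le \frac{C M}{w_\alpha^+(B(x,|y-x|))},\qquad |\nabla_{x,y}K^{\alpha,\varepsilon}(x,y)|\le \frac{1}{|x-y|}\,\frac{C M}{w_\alpha^+(B(x,|y-x|))}.$$ (b) There is a constant $C$, depending only on $d,\alpha,\varepsilon$, such that for every signed or complex Borel measure $\mu$ on $(0,\infty)$ (possibly of infinite total variation, i.e. $d\mu=\sigma\,d|\mu|$ with $|\sigma|=1$ and $|\mu|$ a positive measure) whose total variation measure $|\mu|$ satisfies $$N_\mu=\int_0^\infty e^{-t(2|\alpha|+2d)}\,d|\mu|(t)<\infty,$$ and all $x,y\in\mathbb R^d_+$ with $x\ne y$, the integral $$\mathcal K^{\alpha,\varepsilon}(x,y)=\int_0^\infty G_t^{\alpha,\varepsilon}(x,y)\,d\mu(t)$$ converges absolutely, $\mathcal K^{\alpha,\varepsilon}$ is differentiable at $(x,y)$, and $$|\mathcal K^{\alpha,\varepsilon}(x,y)|\le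 \frac{C N_\mu}{w_\alpha^+(B(x,|y-x|))},\qquad |\nabla_{x,y}\mathcal K^{\alpha,\varepsilon}(x,y)|\le \frac{1}{|x-y|}\,\frac{C N_\mu}{w_\alpha^+(B(x,|y-x|))}.$$ -/

import Mathlib

open MeasureTheory Set

noncomputable section

namespace DunklLaguerre

/-- The open orthant `(0,∞)^d` of the Euclidean space `ℝ^d`. -/
def orthant (d : ℕ) : Set (EuclideanSpace ℝ (Fin d)) := {x | ∀ i, 0 < x i}

/-- The measure `dw_α(x) = ∏ |x_j|^(2 α_j + 1) dx` on `ℝ^d`. -/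
def w {d : ℕ} (α : Fin d → ℝ) : Measure (EuclideanSpace ℝ (Fin d)) :=
  volume.withDensity fun x => ENNReal.ofReal (∏ j, |x j| ^ (2 * α j + 1))

/-- `w_α^+`, the restriction of `w_α` to the orthant `(0,∞)^d`. In particular its value on the
Euclidean ball of centre `x` and radius `r` is the `w_α`-measure of that ball intersected
with the orthant. -/
def wPlus {d : ℕ} (α : Fin d → ℝ) : Measure (EuclideanSpace ℝ (Fin d)) :=
  (w α).restrict (orthant d)

/-- The modified Bessel function of the first kind `I_ν(z)`, for real order `ν` and `z > 0`:
`I_ν(z) = ∑_{m ≥ 0} (z/2)^(2m+ν) / (m! Γ(m+ν+1))`. -/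
def besselI (ν z : ℝ) : ℝ :=
  ∑' m : ℕ, (z / 2) ^ (2 * (m : ℝ) + ν) / ((m.factorial : ℝ) * Real.Gamma ((m : ℝ) + ν + 1))

/-- The component `G_t^{α,ε}(x,y)` of the Dunkl heat kernel, for `t > 0` and `x, y` in the
orthant `(0,∞)^d`, where `ε ∈ {0,1}^d`. -/
def G {d : ℕ} (α : Fin d → ℝ) (ε : Fin d → Fin 2) (t : ℝ)
    (x y : EuclideanSpace ℝ (Fin d)) : ℝ :=
  ((2 * Real.sinh (2 * t)) ^ d)⁻¹ *
    Real.exp (-(1 / 2) * (Real.cosh (2 * t) / Real.sinh (2 * t)) * (‖x‖ ^ 2 + ‖y‖ ^ 2)) *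
    ∏ i, (x i * y i) ^ (ε i : ℕ) *
      (besselI (α i + ((ε i : ℕ) : ℝ)) (x i * y i / Real.sinh (2 * t)) /
        (x i * y i) ^ (α i + ((ε i : ℕ) : ℝ)))

/-- The bottom `λ_0^α = 2|α| + 2d` of the spectrum of the Dunkl harmonic oscillator. -/
def lambda0 {d : ℕ} (α : Fin d → ℝ) : ℝ := 2 * ∑ i, α i + 2 * (d : ℝ)

/-- A signed or complex Borel measure `μ` on `(0,∞)`, whose total variation may be infinite,
given by its polar decomposition `dμ = σ d|μ|`: the field `abs` is the total variation measure
`|μ|` and the field `phase` is the Borel function `σ` with `|σ| = 1`, `|μ|`-almost everywhere.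
(Mathlib's `ComplexMeasure` and `SignedMeasure` only comprise measures of finite
total variation, which leaves out for example `dμ(t) = t^(δ-1) dt`.) -/
structure PolarMeasure where
  /-- The total variation measure `|μ|`. -/
  abs : Measure (Ioi (0 : ℝ))
  /-- The density `σ = dμ / d|μ|`. -/
  phase : Ioi (0 : ℝ) → ℂ
  measurable_phase : Measurable phase
  norm_phase : ∀ᵐ t ∂abs, ‖phase t‖ = 1

/-- The integral `∫ f dμ = ∫ f σ d|μ|` against a signed or complex measure on `(0,∞)`. -/
def PolarMeasure.integral (μ : PolarMeasure) (f : ℝ → ℂ) : ℂ :=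
  ∫ t : Ioi (0 : ℝ), f t * μ.phase t ∂μ.abs

/-- The kernel `K_η^{α,ε}(x,y) = - ∫_0^∞ ∂_t G_t^{α,ε}(x,y) η(t) dt`. -/
def laplaceKernel {d : ℕ} (α : Fin d → ℝ) (ε : Fin d → Fin 2) (η : ℝ → ℂ)
    (x y : EuclideanSpace ℝ (Fin d)) : ℂ :=
  -∫ t in Ioi (0 : ℝ), ((deriv (fun s => G α ε s x y) t : ℝ) : ℂ) * η t

/-- The kernel `𝒦_μ^{α,ε}(x,y) = ∫_{(0,∞)} G_t^{α,ε}(x,y) dμ(t)`. -/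
def stieltjesKernel {d : ℕ} (α : Fin d → ℝ) (ε : Fin d → Fin 2) (μ : PolarMeasure)
    (x y : EuclideanSpace ℝ (Fin d)) : ℂ :=
  μ.integral fun t => (G α ε t x y : ℂ)

/-- The Euclidean length `|∇_{x,y} F(x,y)|` of the full gradient
`(∂_{x_1} F, …, ∂_{x_d} F, ∂_{y_1} F, …, ∂_{y_d} F)` of a complex-valued function `F`
that is differentiable at `(x,y)`. -/
def gradNorm {d : ℕ} (F : EuclideanSpace ℝ (Fin d) → EuclideanSpace ℝ (Fin d) → ℂ)
    (x y : EuclideanSpace ℝ (Fin d)) : ℝ :=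
  Real.sqrt
    (∑ j, ‖fderiv ℝ (Function.uncurry F) (x, y) (EuclideanSpace.single j (1 : ℝ), 0)‖ ^ 2 +
      ∑ j, ‖fderiv ℝ (Function.uncurry F) (x, y) (0, EuclideanSpace.single j (1 : ℝ))‖ ^ 2)

end DunklLaguerre

end

/-!
Up to its exponential growth, the Bessel factor of each one-dimensional kernel is a *symbol*:
`z^ε z^{-ν} I_ν(z) = e^z θ(z)` with `ν = α + ε`, where `θ` and its first two derivatives are
`O((1+z)^(-α-1/2-k))` (`exists_isSymbol_pow_mul_besselI`). This comes from Poisson's integral for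
`I_ν`, proved by comparing Taylor coefficients (`integral_poisson_eq_besselI`), whose substitution
`s = 1 - u` turns `e^{-z} z^{-ν} I_ν(z)` into Laplace transforms of a bounded weight on `[0,2]`.

Hence the kernel is a product of one-dimensional kernels
`(1/2) (sinh 2t)^(-1-α) θ(xy / sinh 2t) e^{-Q}`, where with `τ = tanh t` the exponent is
`Q = (x-y)²/(4τ) + τ(x+y)²/4`. Differentiating one of these in `t` costs a factor `1/τ`,
differentiating in `x` or `y` a factor `τ^(-1/2)`, up to powers of `1+Q` that the Gaussian absorbs
(`exists_factor_family_le`). The inequality `τ + x² ≤ 4τ (1 + xy / sinh 2t)(1 + Q)` trades the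
weight `xy / sinh 2t` of the kernel for the weight `x²` of the measure, so that the majorant is
`e^{-2t(α+1)} τ^(-1/2) (τ+x²)^(-α-1/2) e^{-(x-y)²/(8τ)}`, uniformly in all `t > 0`.

Multiplying over the coordinates, with `r = |x-y|` and `V = r^d ∏ (r+x_i)^(2α_i+1)`, the kernel is
at most `e^{-λ₀ t} V⁻¹` times `w^d (1+w²)^A e^{-w²/8}`, `w = r τ^(-1/2)`
(`prod_majorant_mul_ballWeight_le`). This bounds `e^{λ₀ t} G_t` and `r e^{λ₀ t} |∇G_t|` by
`C/V`; since `d ≥ 1` leaves a positive power of `w`, it also bounds `∂_t G_t` and `r |∇∂_t G_t|`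
by `(C/V) r (t+r²)^(-3/2)`, whose time integral is `2C/V` (`exists_prod_majorant_le`). The measure
of the ball of centre `x` and radius `r` is at most a constant times `V`, because the density is
increasing in each coordinate (`exists_wPlus_ball_le`). Dominated convergence then
gives differentiability off the diagonal together with all the bounds (`kernel_estimates`).
-/

noncomputable section

namespace DunklLaguerre

/-! ### Symbols on the half-line -/

/-- `f` is a symbol of order `-a` on `[0,∞)`, up to two derivatives: `f` is twice continuously
differentiable on `ℝ` with derivatives `f₁`, `f₂`, and its `k`-th derivative is
`O((1+z)^(-a-k))` for `z ≥ 0` and `k = 0, 1, 2`. -/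
structure IsSymbol (a : ℝ) (f f₁ f₂ : ℝ → ℝ) : Prop where
  hasDerivAt : ∀ z, HasDerivAt f (f₁ z) z
  hasDerivAt' : ∀ z, HasDerivAt f₁ (f₂ z) z
  continuous : Continuous f₂
  bound : ∃ C, ∀ z, 0 ≤ z → |f z| ≤ C * (1 + z) ^ (-a) ∧ |f₁ z| ≤ C * (1 + z) ^ (-a - 1) ∧
    |f₂ z| ≤ C * (1 + z) ^ (-a - 2)

namespace IsSymbol

variable {a b : ℝ} {f f₁ f₂ g g₁ g₂ : ℝ → ℝ}

lemma mono (hf : IsSymbol b f f₁ f₂) (hab : a ≤ b) : IsSymbol a f f₁ f₂ := by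
  refine ⟨hf.hasDerivAt, hf.hasDerivAt', hf.continuous, ?_⟩
  obtain ⟨C, hC⟩ := hf.bound
  have hC0 : 0 ≤ C := by simpa using (abs_nonneg _).trans (hC 0 le_rfl).1
  refine ⟨C, fun z hz => ?_⟩
  obtain ⟨h0, h1, h2⟩ := hC z hz
  have h : 1 ≤ 1 + z := by linarith
  refine ⟨h0.trans ?_, h1.trans ?_, h2.trans ?_⟩ <;> gcongr

lemma add (hf : IsSymbol a f f₁ f₂) (hg : IsSymbol a g g₁ g₂) :
    IsSymbol a (fun z => f z + g z) (fun z => f₁ z + g₁ z) (fun z => f₂ z + g₂ z) := by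
  refine ⟨fun z => (hf.hasDerivAt z).add (hg.hasDerivAt z),
    fun z => (hf.hasDerivAt' z).add (hg.hasDerivAt' z), hf.continuous.add hg.continuous, ?_⟩
  obtain ⟨C, hC⟩ := hf.bound
  obtain ⟨D, hD⟩ := hg.bound
  refine ⟨C + D, fun z hz => ?_⟩
  obtain ⟨h0, h1, h2⟩ := hC z hz
  obtain ⟨k0, k1, k2⟩ := hD z hz
  simp only [add_mul]
  exact ⟨(abs_add_le _ _).trans (by gcongr), (abs_add_le _ _).trans (by gcongr),
    (abs_add_le _ _).trans (by gcongr)⟩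

lemma const_mul (c : ℝ) (hf : IsSymbol a f f₁ f₂) :
    IsSymbol a (fun z => c * f z) (fun z => c * f₁ z) (fun z => c * f₂ z) := by
  refine ⟨fun z => (hf.hasDerivAt z).const_mul c, fun z => (hf.hasDerivAt' z).const_mul c,
    hf.continuous.const_mul c, ?_⟩
  obtain ⟨C, hC⟩ := hf.bound
  refine ⟨|c| * C, fun z hz => ?_⟩
  obtain ⟨h0, h1, h2⟩ := hC z hz
  simp only [abs_mul, mul_assoc]
  exact ⟨by gcongr, by gcongr, by gcongr⟩

/-- Multiplication by the variable raises the order of a symbol by one. -/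
lemma id_mul (hf : IsSymbol a f f₁ f₂) :
    IsSymbol (a - 1) (fun z => z * f z) (fun z => f z + z * f₁ z)
      (fun z => 2 * f₁ z + z * f₂ z) := by
  have hf0 : Continuous f₁ := continuous_iff_continuousAt.2 fun z => (hf.hasDerivAt' z).continuousAt
  refine ⟨fun z => ?_, fun z => ?_, ?_, ?_⟩
  · exact ((hasDerivAt_id' z).fun_mul (hf.hasDerivAt z)).congr_deriv (by ring)
  · exact ((hf.hasDerivAt z).fun_add ((hasDerivAt_id' z).fun_mul (hf.hasDerivAt' z))).congr_deriv
      (by ring)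
  · have := hf.continuous
    fun_prop
  obtain ⟨C, hC⟩ := hf.bound
  have hC0 : 0 ≤ C := by simpa using (abs_nonneg _).trans (hC 0 le_rfl).1
  refine ⟨3 * C, fun z hz => ?_⟩
  obtain ⟨h0, h1, h2⟩ := hC z hz
  have h : 0 < 1 + z := by linarith
  have e (s : ℝ) : z * (1 + z) ^ (s - 1) ≤ (1 + z) ^ s := by
    have := Real.rpow_add_one h.ne' (s - 1)
    rw [sub_add_cancel] at this
    rw [this, mul_comm]
    gcongr
    linarith
  have e0 := e (-a + 1)
  have e1 := e (-a)
  have e2 := e (-a - 1)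
  have p0 : 0 ≤ (1 + z) ^ (-a + 1) := by positivity
  have p1 : 0 ≤ (1 + z) ^ (-a) := by positivity
  have p2 : 0 ≤ (1 + z) ^ (-a - 1) := by positivity
  rw [show -a + 1 - 1 = -a by ring] at e0
  rw [show -a - 1 - 1 = -a - 2 by ring] at e2
  rw [show -(a - 1) = -a + 1 by ring, show -a + 1 - 1 = -a by ring,
    show -a + 1 - 2 = -a - 1 by ring]
  refine ⟨?_, ?_, ?_⟩
  · rw [abs_mul, abs_of_nonneg hz]
    calc z * |f z| ≤ z * (C * (1 + z) ^ (-a)) := by gcongr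
      _ = C * (z * (1 + z) ^ (-a)) := by ring
      _ ≤ C * (1 + z) ^ (-a + 1) := by gcongr
      _ ≤ _ := by nlinarith [mul_nonneg hC0 p0]
  · calc |f z + z * f₁ z| ≤ |f z| + z * |f₁ z| := by
          simpa [abs_mul, abs_of_nonneg hz] using abs_add_le (f z) (z * f₁ z)
      _ ≤ C * (1 + z) ^ (-a) + z * (C * (1 + z) ^ (-a - 1)) := by gcongr
      _ = C * (1 + z) ^ (-a) + C * (z * (1 + z) ^ (-a - 1)) := by ring
      _ ≤ C * (1 + z) ^ (-a) + C * (1 + z) ^ (-a) := by gcongr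
      _ ≤ _ := by nlinarith [mul_nonneg hC0 p1]
  · calc |2 * f₁ z + z * f₂ z| ≤ 2 * |f₁ z| + z * |f₂ z| := by
          simpa [abs_mul, abs_of_nonneg hz] using abs_add_le (2 * f₁ z) (z * f₂ z)
      _ ≤ 2 * (C * (1 + z) ^ (-a - 1)) + z * (C * (1 + z) ^ (-a - 2)) := by gcongr
      _ = 2 * (C * (1 + z) ^ (-a - 1)) + C * (z * (1 + z) ^ (-a - 2)) := by ring
      _ ≤ 2 * (C * (1 + z) ^ (-a - 1)) + C * (1 + z) ^ (-a - 1) := by gcongr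
      _ = _ := by ring

end IsSymbol

/-! ### The Laplace transform of the Poisson weight -/

/-- The Laplace transform `∫_0^2 u^k e^{-zu} (u(2-u))^γ du`. -/
def laplaceMoment (γ : ℝ) (k : ℕ) (z : ℝ) : ℝ :=
  ∫ u in (0 : ℝ)..2, u ^ k * Real.exp (-(z * u)) * (u * (2 - u)) ^ γ

lemma continuous_laplaceMoment_integrand {γ : ℝ} (hγ : 0 ≤ γ) (k : ℕ) (z : ℝ) :
    Continuous fun u : ℝ => u ^ k * Real.exp (-(z * u)) * (u * (2 - u)) ^ γ := by
  have : Continuous fun u : ℝ => (u * (2 - u)) ^ γ :=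
    (Real.continuous_rpow_const hγ).comp (by fun_prop)
  fun_prop

lemma hasDerivAt_laplaceMoment {γ : ℝ} (hγ : 0 ≤ γ) (k : ℕ) (z : ℝ) :
    HasDerivAt (laplaceMoment γ k) (-laplaceMoment γ (k + 1) z) z := by
  have hc : Continuous fun u : ℝ => (u * (2 - u)) ^ γ :=
    (Real.continuous_rpow_const hγ).comp (by fun_prop)
  have key := (intervalIntegral.hasDerivAt_integral_of_dominated_loc_of_deriv_le
    (μ := volume) (a := 0) (b := 2) (s := Metric.ball z 1)
    (F := fun z u => u ^ k * Real.exp (-(z * u)) * (u * (2 - u)) ^ γ)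
    (F' := fun z u => -(u ^ (k + 1) * Real.exp (-(z * u)) * (u * (2 - u)) ^ γ)) (x₀ := z)
    (bound := fun u => |u| ^ (k + 1) * Real.exp ((|z| + 1) * |u|) * |(u * (2 - u)) ^ γ|)
    (Metric.ball_mem_nhds z one_pos)
    (Filter.Eventually.of_forall fun y =>
      (continuous_laplaceMoment_integrand hγ k y).aestronglyMeasurable)
    ((continuous_laplaceMoment_integrand hγ k z).intervalIntegrable _ _)
    (continuous_laplaceMoment_integrand hγ (k + 1) z).neg.aestronglyMeasurable
    (Filter.Eventually.of_forall fun u _ y hy => ?_)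
    (Continuous.intervalIntegrable (by fun_prop) _ _)
    (Filter.Eventually.of_forall fun u _ y _ => ?_)).2
  · exact key.congr_deriv intervalIntegral.integral_neg
  · rw [norm_neg, Real.norm_eq_abs, abs_mul, abs_mul, abs_pow, Real.abs_exp]
    gcongr
    rw [Metric.mem_ball, Real.dist_eq] at hy
    have : |y| ≤ |z| + 1 := by
      have := abs_add_le (y - z) z
      rw [sub_add_cancel] at this
      linarith
    calc -(y * u) ≤ |y * u| := neg_le_abs _
      _ = |y| * |u| := abs_mul _ _
      _ ≤ _ := by gcongr
  · have h1 : HasDerivAt (fun y : ℝ => -(y * u)) (-u) y := by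
      simpa using ((hasDerivAt_id' y).mul_const u).fun_neg
    exact ((h1.exp.const_mul (u ^ k)).mul_const ((u * (2 - u)) ^ γ)).congr_deriv (by ring)

/-- The Gamma-integral bound for the Laplace transform of the Poisson weight. Since `u ≤ 2` on the
range of integration, `e^{-zu} ≤ e^2 e^{-(1+z)u}`, which covers small `z` as well. -/
lemma exists_abs_laplaceMoment_le {γ : ℝ} (hγ : 0 ≤ γ) (k : ℕ) :
    ∃ C, ∀ z, 0 ≤ z → |laplaceMoment γ k z| ≤ C * (1 + z) ^ (-(γ + 1) - k) := by
  refine ⟨2 ^ γ * Real.exp 2 * Real.Gamma (k + γ + 1), fun z hz => ?_⟩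
  have h1 : 0 < 1 + z := by linarith
  have hpos : 0 < (k : ℝ) + γ + 1 := by positivity
  have hint := Real.integral_rpow_mul_exp_neg_mul_Ioi hpos h1
  have hnn : ∀ u ∈ Ioc (0 : ℝ) 2, 0 ≤ u * (2 - u) := fun u hu =>
    mul_nonneg hu.1.le (by linarith [hu.2])
  have hIoi : IntegrableOn (fun u : ℝ => 2 ^ γ * Real.exp 2 *
      (u ^ ((k : ℝ) + γ + 1 - 1) * Real.exp (-((1 + z) * u)))) (Ioi 0) := by
    refine Integrable.const_mul (not_imp_comm.1 integral_undef ?_) _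
    rw [hint]
    exact (mul_pos (by positivity) (Real.Gamma_pos_of_pos hpos)).ne'
  have hnn' : 0 ≤ laplaceMoment γ k z := by
    rw [laplaceMoment, intervalIntegral.integral_of_le zero_le_two]
    refine setIntegral_nonneg measurableSet_Ioc fun u hu => ?_
    have := hnn u hu
    have := hu.1.le
    positivity
  rw [abs_of_nonneg hnn', laplaceMoment, intervalIntegral.integral_of_le zero_le_two]
  calc _ ≤ ∫ u in Ioc (0 : ℝ) 2, 2 ^ γ * Real.exp 2 *
      (u ^ ((k : ℝ) + γ + 1 - 1) * Real.exp (-((1 + z) * u))) := by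
        refine setIntegral_mono_on ?_ (hIoi.mono_set Ioc_subset_Ioi_self) measurableSet_Ioc
          fun u hu => ?_
        · exact ((continuous_laplaceMoment_integrand hγ k z).intervalIntegrable 0 2).1
        · have hu0 := hu.1
          have hu2 := hu.2
          have e1 : (u * (2 - u)) ^ γ ≤ 2 ^ γ * u ^ γ := by
            rw [← Real.mul_rpow zero_le_two hu0.le]
            exact Real.rpow_le_rpow (hnn u hu) (by nlinarith) hγ
          have e2 : Real.exp (-(z * u)) ≤ Real.exp 2 * Real.exp (-((1 + z) * u)) := by
            rw [← Real.exp_add]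
            gcongr
            nlinarith
          have e3 : u ^ ((k : ℝ) + γ + 1 - 1) = u ^ k * u ^ γ := by
            rw [add_sub_cancel_right, Real.rpow_add hu0, Real.rpow_natCast]
          calc _ ≤ u ^ k * (Real.exp 2 * Real.exp (-((1 + z) * u))) * (2 ^ γ * u ^ γ) := by
                have := hnn u hu
                gcongr
            _ = _ := by rw [e3]; ring
    _ ≤ ∫ u in Ioi (0 : ℝ), 2 ^ γ * Real.exp 2 *
      (u ^ ((k : ℝ) + γ + 1 - 1) * Real.exp (-((1 + z) * u))) := by
        refine setIntegral_mono_set hIoi ?_ (Filter.Eventually.of_forall Ioc_subset_Ioi_self)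
        refine (ae_restrict_iff' measurableSet_Ioi).2 (Filter.Eventually.of_forall fun u hu => ?_)
        have : (0 : ℝ) < u := hu
        simp only [Pi.zero_apply]
        positivity
    _ = _ := by
        rw [integral_const_mul, hint, one_div, Real.inv_rpow h1.le, ← Real.rpow_neg h1.le,
          show -((k : ℝ) + γ + 1) = -(γ + 1) - k by ring]
        ring

lemma isSymbol_laplaceMoment {γ : ℝ} (hγ : 0 ≤ γ) (k : ℕ) :
    IsSymbol (γ + 1 + k) (laplaceMoment γ k) (fun z => -laplaceMoment γ (k + 1) z)
      (laplaceMoment γ (k + 2)) := by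
  refine ⟨hasDerivAt_laplaceMoment hγ k, fun z => ?_, ?_, ?_⟩
  · simpa using (hasDerivAt_laplaceMoment hγ (k + 1) z).fun_neg
  · exact continuous_iff_continuousAt.2 fun z => (hasDerivAt_laplaceMoment hγ _ z).continuousAt
  obtain ⟨C₀, h₀⟩ := exists_abs_laplaceMoment_le hγ k
  obtain ⟨C₁, h₁⟩ := exists_abs_laplaceMoment_le hγ (k + 1)
  obtain ⟨C₂, h₂⟩ := exists_abs_laplaceMoment_le hγ (k + 2)
  refine ⟨max C₀ (max C₁ C₂), fun z hz => ⟨?_, ?_, ?_⟩⟩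
  · refine (h₀ z hz).trans ?_
    rw [show -(γ + 1) - (k : ℝ) = -(γ + 1 + k) by ring]
    gcongr
    exact le_max_left _ _
  · rw [abs_neg]
    refine (h₁ z hz).trans ?_
    rw [show -(γ + 1) - ((k + 1 : ℕ) : ℝ) = -(γ + 1 + k) - 1 by push_cast; ring]
    gcongr
    exact (le_max_left _ _).trans (le_max_right _ _)
  · refine (h₂ z hz).trans ?_
    rw [show -(γ + 1) - ((k + 2 : ℕ) : ℝ) = -(γ + 1 + k) - 2 by push_cast; ring]
    gcongr
    exact (le_max_right _ _).trans (le_max_right _ _)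

/-! ### Poisson's integral for the modified Bessel function -/

/-- The moments `∫_{-1}^1 s^n (1-s²)^γ ds` of the Poisson weight. -/
def poissonMoment (γ : ℝ) (n : ℕ) : ℝ := ∫ s in (-1 : ℝ)..1, s ^ n * (1 - s ^ 2) ^ γ

lemma continuous_poissonWeight {γ : ℝ} (hγ : 0 ≤ γ) : Continuous fun s : ℝ => (1 - s ^ 2) ^ γ :=
  (Real.continuous_rpow_const hγ).comp (by fun_prop)

lemma poissonMoment_zero_pos {γ : ℝ} (hγ : 0 ≤ γ) : 0 < poissonMoment γ 0 := by
  have := continuous_poissonWeight hγ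
  refine intervalIntegral.intervalIntegral_pos_of_pos_on
    (Continuous.intervalIntegrable (by fun_prop) _ _) (fun s hs => ?_) (by norm_num)
  have : 0 < 1 - s ^ 2 := by nlinarith [hs.1, hs.2]
  positivity

lemma poissonMoment_odd (γ : ℝ) (m : ℕ) : poissonMoment γ (2 * m + 1) = 0 := by
  have h := intervalIntegral.integral_comp_neg (a := -1) (b := 1)
    (fun s : ℝ => s ^ (2 * m + 1) * (1 - s ^ 2) ^ γ)
  have e : ∀ s : ℝ, (-s) ^ (2 * m + 1) = -s ^ (2 * m + 1) := fun s => Odd.neg_pow ⟨m, rfl⟩ s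
  simp only [e, neg_sq, neg_mul, neg_neg, intervalIntegral.integral_neg] at h
  rw [poissonMoment]
  linarith

/-- Integration by parts against `s^(2m+1) (1-s²)^(γ+1)`. -/
lemma poissonMoment_even_succ {γ : ℝ} (hγ : 0 ≤ γ) (m : ℕ) :
    (2 * m + 2 * γ + 3) * poissonMoment γ (2 * (m + 1)) =
      (2 * m + 1) * poissonMoment γ (2 * m) := by
  have hw := continuous_poissonWeight hγ
  have hI (n : ℕ) : IntervalIntegrable (fun s : ℝ => s ^ n * (1 - s ^ 2) ^ γ) volume (-1) 1 :=
    Continuous.intervalIntegrable (by fun_prop) _ _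
  have hd (s : ℝ) : HasDerivAt (fun s : ℝ => s ^ (2 * m + 1) * (1 - s ^ 2) ^ (γ + 1))
      ((2 * m + 1) * s ^ (2 * m) * (1 - s ^ 2) ^ (γ + 1) +
        s ^ (2 * m + 1) * (-(2 * s) * (γ + 1) * (1 - s ^ 2) ^ γ)) s := by
    have h1 : HasDerivAt (fun s : ℝ => 1 - s ^ 2) (-(2 * s)) s := by
      simpa using (hasDerivAt_pow 2 s).const_sub 1
    have h2 := h1.rpow_const (p := γ + 1) (Or.inr (by linarith))
    exact ((hasDerivAt_pow (2 * m + 1) s).fun_mul h2).congr_deriv (by simp)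
  have hcont : Continuous fun s : ℝ => (1 - s ^ 2) ^ (γ + 1) :=
    continuous_poissonWeight (by linarith)
  have hFTC := intervalIntegral.integral_eq_sub_of_hasDerivAt (a := -1) (b := 1)
    (fun s _ => hd s) (Continuous.intervalIntegrable (by fun_prop) _ _)
  have hz : γ + 1 ≠ 0 := by linarith
  have heq : ∫ s in (-1 : ℝ)..1, ((2 * m + 1) * s ^ (2 * m) * (1 - s ^ 2) ^ (γ + 1) +
        s ^ (2 * m + 1) * (-(2 * s) * (γ + 1) * (1 - s ^ 2) ^ γ)) =
      ∫ s in (-1 : ℝ)..1, ((2 * m + 1) * (s ^ (2 * m) * (1 - s ^ 2) ^ γ) -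
        (2 * m + 2 * γ + 3) * (s ^ (2 * (m + 1)) * (1 - s ^ 2) ^ γ)) := by
    refine intervalIntegral.integral_congr fun s hs => ?_
    rw [uIcc_of_le (by norm_num)] at hs
    have : 0 ≤ 1 - s ^ 2 := by nlinarith [hs.1, hs.2]
    simp only [Real.rpow_add_one' this hz]
    ring
  rw [heq, intervalIntegral.integral_sub ((hI _).const_mul _) ((hI _).const_mul _),
    intervalIntegral.integral_const_mul, intervalIntegral.integral_const_mul] at hFTC
  simp only [one_pow, sub_self, Real.zero_rpow hz, mul_zero, even_two, Even.neg_pow] at hFTC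
  simp only [poissonMoment]
  linarith

lemma poissonMoment_even {γ : ℝ} (hγ : 0 ≤ γ) (m : ℕ) :
    poissonMoment γ (2 * m) / (2 * m).factorial =
      poissonMoment γ 0 * Real.Gamma (γ + 3 / 2) /
        (4 ^ m * m.factorial * Real.Gamma (m + γ + 3 / 2)) := by
  induction m with
  | zero =>
    have : Real.Gamma (γ + 3 / 2) ≠ 0 := (Real.Gamma_pos_of_pos (by linarith)).ne'
    simp [this]
  | succ m ih =>
    have hG : Real.Gamma (m + γ + 3 / 2) ≠ 0 := (Real.Gamma_pos_of_pos (by positivity)).ne'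
    have hr := poissonMoment_even_succ hγ m
    have hne : (m : ℝ) + γ + 3 / 2 ≠ 0 := by positivity
    have hGs : Real.Gamma (((m + 1 : ℕ) : ℝ) + γ + 3 / 2) =
        (m + γ + 3 / 2) * Real.Gamma (m + γ + 3 / 2) := by
      rw [← Real.Gamma_add_one hne]
      push_cast
      ring_nf
    have hf : ((2 * (m + 1)).factorial : ℝ) = (2 * m + 2) * ((2 * m + 1) * (2 * m).factorial) := by
      rw [show 2 * (m + 1) = 2 * m + 1 + 1 by ring, Nat.factorial_succ, Nat.factorial_succ]
      push_cast
      ring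
    have hJ : poissonMoment γ (2 * (m + 1)) =
        (2 * m + 1) * poissonMoment γ (2 * m) / (2 * m + 2 * γ + 3) := by
      rw [eq_div_iff (by positivity), ← hr]
      ring
    rw [hGs, hf, hJ, Nat.factorial_succ]
    have h1 : poissonMoment γ (2 * m) = (2 * m).factorial * (poissonMoment γ 0 *
      Real.Gamma (γ + 3 / 2) / (4 ^ m * m.factorial * Real.Gamma (m + γ + 3 / 2))) := by
      rw [← ih]; field_simp
    have h3 : (2 * m + 2 * γ + 3 : ℝ) = 2 * (m + γ + 3 / 2) := by ring
    rw [h1, h3]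
    push_cast
    field_simp
    ring

/-- Poisson's integral. The integrand carries the factor `zs + 2γ + 1` in place of a constant,
which corresponds to expressing `I_ν` through `I_{ν+1}`; in this form the weight `(1-s²)^γ`,
`γ = ν + 1/2`, is bounded also for `ν < 1/2`, and `ν = -1/2` is no exception. -/
lemma integral_poisson_eq_besselI {γ : ℝ} (hγ : 0 ≤ γ) {z : ℝ} (hz : 0 < z) :
    ∫ s in (-1 : ℝ)..1, (z * s + (2 * γ + 1)) * Real.exp (z * s) * (1 - s ^ 2) ^ γ =
      2 ^ (γ + 1 / 2) * poissonMoment γ 0 * Real.Gamma (γ + 3 / 2) *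
        (besselI (γ - 1 / 2) z / z ^ (γ - 1 / 2)) := by
  have hw := continuous_poissonWeight hγ
  have hexp (x : ℝ) : HasSum (fun n : ℕ => x ^ n / n.factorial) (Real.exp x) := by
    rw [Real.exp_eq_exp_ℝ]
    exact NormedSpace.expSeries_div_hasSum_exp x
  have hexp' (x : ℝ) : HasSum (fun n : ℕ => (n : ℝ) * (x ^ n / n.factorial)) (x * Real.exp x) := by
    rw [← hasSum_nat_add_iff' 1]
    simp only [Finset.range_one, Finset.sum_singleton, Nat.cast_zero, zero_mul, sub_zero]
    convert! (hexp x).mul_left x using 2 with n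
    rw [Nat.factorial_succ]
    push_cast
    have : ((n : ℝ) + 1) ≠ 0 := by positivity
    field_simp
    ring
  have hboth (x : ℝ) : HasSum (fun n : ℕ => ((n : ℝ) + (2 * γ + 1)) * (x ^ n / n.factorial))
      ((x + (2 * γ + 1)) * Real.exp x) := by
    simp only [add_mul _ (2 * γ + 1)]
    exact (hexp' x).add ((hexp x).mul_left _)
  have hsum := intervalIntegral.hasSum_integral_of_dominated_convergence (μ := volume)
    (a := -1) (b := 1)
    (F := fun (n : ℕ) (s : ℝ) =>
      ((n : ℝ) + (2 * γ + 1)) * ((z * s) ^ n / n.factorial) * (1 - s ^ 2) ^ γ)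
    (f := fun s => (z * s + (2 * γ + 1)) * Real.exp (z * s) * (1 - s ^ 2) ^ γ)
    (fun n _ => ((n : ℝ) + (2 * γ + 1)) * (z ^ n / n.factorial))
    (fun n => Continuous.aestronglyMeasurable (by fun_prop))
    (fun n => Filter.Eventually.of_forall fun s hs => ?_)
    (Filter.Eventually.of_forall fun s _ => (hboth z).summable)
    (by simp)
    (Filter.Eventually.of_forall fun s _ => (hboth (z * s)).mul_right _)
  swap
  · rw [uIoc_of_le (by norm_num)] at hs
    have h0 : 0 ≤ 1 - s ^ 2 := by nlinarith [hs.1, hs.2]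
    have h1 : (1 - s ^ 2) ^ γ ≤ 1 := Real.rpow_le_one h0 (by nlinarith) hγ
    have h2 : |s| ^ n ≤ 1 := pow_le_one₀ (abs_nonneg _) (abs_le.2 ⟨hs.1.le, hs.2⟩)
    have h3 : 0 ≤ (1 - s ^ 2) ^ γ := by positivity
    rw [Real.norm_eq_abs, abs_mul, abs_of_nonneg h3, abs_mul, abs_div, abs_pow, abs_mul,
      abs_of_pos hz, Nat.abs_cast, abs_of_nonneg (by positivity : 0 ≤ (n : ℝ) + (2 * γ + 1)),
      mul_pow]
    calc _ ≤ ((n : ℝ) + (2 * γ + 1)) * (z ^ n * 1 / n.factorial) * 1 := by gcongr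
      _ = _ := by ring
  have hterm (n : ℕ) : ∫ s in (-1 : ℝ)..1,
      ((n : ℝ) + (2 * γ + 1)) * ((z * s) ^ n / n.factorial) * (1 - s ^ 2) ^ γ =
      ((n : ℝ) + (2 * γ + 1)) * z ^ n * (poissonMoment γ n / n.factorial) := by
    rw [poissonMoment, ← intervalIntegral.integral_div, ← intervalIntegral.integral_const_mul]
    refine intervalIntegral.integral_congr fun s _ => ?_
    simp only [mul_pow]
    ring
  simp only [hterm] at hsum
  have hinj : Function.Injective fun m : ℕ => 2 * m := fun a b h => by simpa using h
  rw [← hinj.hasSum_iff] at hsum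
  swap
  · intro n hn
    obtain ⟨m, rfl | rfl⟩ := n.even_or_odd'
    · exact absurd ⟨m, rfl⟩ hn
    · simp [poissonMoment_odd]
  rw [← hsum.tsum_eq, besselI, ← tsum_div_const, ← tsum_mul_left]
  refine tsum_congr fun m => ?_
  simp only [Function.comp]
  have hne : (m : ℝ) + γ + 1 / 2 ≠ 0 := by positivity
  have hG : Real.Gamma (m + γ + 1 / 2) ≠ 0 := (Real.Gamma_pos_of_pos (by positivity)).ne'
  have hGs : Real.Gamma ((m : ℝ) + γ + 3 / 2) = (m + γ + 1 / 2) * Real.Gamma (m + γ + 1 / 2) := by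
    rw [← Real.Gamma_add_one hne]
    ring_nf
  have hpow : (z / 2) ^ (2 * (m : ℝ) + (γ - 1 / 2)) =
      z ^ (2 * m) * z ^ (γ - 1 / 2) / (4 ^ m * (2 ^ (γ + 1 / 2) / 2)) := by
    rw [Real.div_rpow hz.le zero_le_two, Real.rpow_add hz, Real.rpow_add two_pos]
    congr 1
    · rw [← Real.rpow_natCast]
      push_cast
      rfl
    · rw [Real.rpow_mul zero_le_two, ← Real.rpow_natCast 4 m,
        show γ - 1 / 2 = γ + 1 / 2 - 1 by ring, Real.rpow_sub_one two_ne_zero]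
      norm_num
  rw [poissonMoment_even hγ, hGs, hpow, show (m : ℝ) + (γ - 1 / 2) + 1 = m + γ + 1 / 2 by ring]
  have hzp : z ^ (γ - 1 / 2) ≠ 0 := by positivity
  have h2p : (2 : ℝ) ^ (γ + 1 / 2) ≠ 0 := by positivity
  push_cast
  field_simp
  ring

/-- The function `e^{-z} z^{-ν} I_ν(z)`, `ν ≥ -1/2`, is the restriction to `(0,∞)` of a symbol of
order `-(ν+1/2)`. -/
lemma exists_isSymbol_besselI {γ : ℝ} (hγ : 0 ≤ γ) :
    ∃ ψ ψ₁ ψ₂ : ℝ → ℝ, IsSymbol γ ψ ψ₁ ψ₂ ∧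
      ∀ z, 0 < z → besselI (γ - 1 / 2) z / z ^ (γ - 1 / 2) = Real.exp z * ψ z := by
  have s0 := isSymbol_laplaceMoment hγ 0
  have s1 := (isSymbol_laplaceMoment hγ 1).id_mul.mono (a := γ) (by push_cast; linarith)
  have s2 := s0.id_mul.mono (a := γ) (by push_cast; linarith)
  have s3 := s0.mono (a := γ) (by push_cast; linarith)
  have hK : 0 < 2 ^ (γ + 1 / 2) * poissonMoment γ 0 * Real.Gamma (γ + 3 / 2) := by
    have := poissonMoment_zero_pos hγ
    have := Real.Gamma_pos_of_pos (by linarith : 0 < γ + 3 / 2)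
    positivity
  refine ⟨_, _, _, ((s2.add (s1.const_mul (-1))).add (s3.const_mul (2 * γ + 1))).const_mul
    (2 ^ (γ + 1 / 2) * poissonMoment γ 0 * Real.Gamma (γ + 3 / 2))⁻¹, fun z hz => ?_⟩
  have hp := integral_poisson_eq_besselI hγ hz
  -- the substitution `s = 1 - u` splits off the factor `e^z`
  have hsub : ∫ s in (-1 : ℝ)..1, (z * s + (2 * γ + 1)) * Real.exp (z * s) * (1 - s ^ 2) ^ γ =
      ∫ u in (0 : ℝ)..2, Real.exp z * ((z * (u ^ 0 * Real.exp (-(z * u)) * (u * (2 - u)) ^ γ) -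
        z * (u ^ 1 * Real.exp (-(z * u)) * (u * (2 - u)) ^ γ)) +
        (2 * γ + 1) * (u ^ 0 * Real.exp (-(z * u)) * (u * (2 - u)) ^ γ)) := by
    have h := intervalIntegral.integral_comp_sub_left (a := 0) (b := 2)
      (fun s : ℝ => (z * s + (2 * γ + 1)) * Real.exp (z * s) * (1 - s ^ 2) ^ γ) 1
    rw [show (1 : ℝ) - 2 = -1 by norm_num, sub_zero] at h
    rw [← h]
    refine intervalIntegral.integral_congr fun u _ => ?_
    rw [show 1 - (1 - u) ^ 2 = u * (2 - u) by ring, show z * (1 - u) = z + -(z * u) by ring,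
      Real.exp_add]
    ring
  have hI (k : ℕ) := (continuous_laplaceMoment_integrand hγ k z).intervalIntegrable
    (μ := volume) 0 2
  rw [hsub, intervalIntegral.integral_const_mul,
    intervalIntegral.integral_add (((hI 0).const_mul _).sub ((hI 1).const_mul _))
      ((hI 0).const_mul _),
    intervalIntegral.integral_sub ((hI 0).const_mul _) ((hI 1).const_mul _),
    intervalIntegral.integral_const_mul, intervalIntegral.integral_const_mul,
    intervalIntegral.integral_const_mul] at hp
  change Real.exp z * (z * laplaceMoment γ 0 z - z * laplaceMoment γ 1 z +
    (2 * γ + 1) * laplaceMoment γ 0 z) = _ at hp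
  have hb : besselI (γ - 1 / 2) z / z ^ (γ - 1 / 2) =
      (2 ^ (γ + 1 / 2) * poissonMoment γ 0 * Real.Gamma (γ + 3 / 2))⁻¹ *
        (Real.exp z * (z * laplaceMoment γ 0 z - z * laplaceMoment γ 1 z +
          (2 * γ + 1) * laplaceMoment γ 0 z)) := by
    rw [hp, inv_mul_cancel_left₀ hK.ne']
  rw [hb]
  ring

/-- The Bessel factor of the kernel, with the power `(xy)^ε` included: up to the exponential it is
a symbol of order `-(α+1/2)` for both values of `ε`. -/
lemma exists_isSymbol_pow_mul_besselI {α : ℝ} (hα : -(1 / 2) ≤ α) (ε : Fin 2) :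
    ∃ θ θ₁ θ₂ : ℝ → ℝ, IsSymbol (α + 1 / 2) θ θ₁ θ₂ ∧ ∀ z, 0 < z →
      z ^ (ε : ℕ) * (besselI (α + ((ε : ℕ) : ℝ)) z / z ^ (α + ((ε : ℕ) : ℝ))) =
        Real.exp z * θ z := by
  fin_cases ε
  · obtain ⟨ψ, ψ₁, ψ₂, h, he⟩ := exists_isSymbol_besselI (γ := α + 1 / 2) (by linarith)
    refine ⟨ψ, ψ₁, ψ₂, h, fun z hz => ?_⟩
    have := he z hz
    rw [show α + 1 / 2 - 1 / 2 = α by ring] at this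
    simpa using this
  · obtain ⟨ψ, ψ₁, ψ₂, h, he⟩ := exists_isSymbol_besselI (γ := α + 3 / 2) (by linarith)
    refine ⟨_, _, _, h.id_mul.mono (a := α + 1 / 2) (by linarith), fun z hz => ?_⟩
    have := he z hz
    rw [show α + 3 / 2 - 1 / 2 = α + 1 by ring] at this
    simp only [pow_one, Nat.cast_one, this]
    ring

/-! ### The one-dimensional kernel and its derivatives -/

/-- `1 / sinh 2t`. -/
def csch (t : ℝ) : ℝ := (Real.sinh (2 * t))⁻¹

/-- `coth 2t`. -/
def coth (t : ℝ) : ℝ := Real.cosh (2 * t) / Real.sinh (2 * t)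

/-- The exponent `Q = (1/2) coth(2t) (x²+y²) - xy / sinh 2t` of the Mehler kernel. -/
def mehlerExp (t x y : ℝ) : ℝ := coth t / 2 * (x ^ 2 + y ^ 2) - csch t * (x * y)

/-- `∂_t Q`. -/
def mehlerExpT (t x y : ℝ) : ℝ := 2 * csch t * coth t * (x * y) - csch t ^ 2 * (x ^ 2 + y ^ 2)

/-- `∂_x Q`. -/
def mehlerExpX (t x y : ℝ) : ℝ := coth t * x - csch t * y

/-- The factor `(1/2) (sinh 2t)^(-1-α) e^{-Q}`. -/
def mehlerFactor (α t x y : ℝ) : ℝ := csch t ^ (1 + α) / 2 * Real.exp (-mehlerExp t x y)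

/-- The one-dimensional kernel `(1/2) (sinh 2t)^(-1-α) θ(xy / sinh 2t) e^{-Q}` built from a
symbol `θ`. -/
def factor (α : ℝ) (θ : ℝ → ℝ) (t x y : ℝ) : ℝ := mehlerFactor α t x y * θ (csch t * (x * y))

/-- The quotient of `∂_t` of the one-dimensional kernel by `(1/2) (sinh 2t)^(-1-α) e^{-Q}`. -/
def factorTAux (α : ℝ) (θ θ₁ : ℝ → ℝ) (t x y : ℝ) : ℝ :=
  -(2 * coth t * (1 + α) * θ (csch t * (x * y))) -
    2 * coth t * ((csch t * (x * y)) * θ₁ (csch t * (x * y))) -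
    mehlerExpT t x y * θ (csch t * (x * y))

/-- The `∂_t`-derivative of the one-dimensional kernel. -/
def factorT (α : ℝ) (θ θ₁ : ℝ → ℝ) (t x y : ℝ) : ℝ :=
  mehlerFactor α t x y * factorTAux α θ θ₁ t x y

/-- The `∂_x`-derivative of the one-dimensional kernel. -/
def factorX (α : ℝ) (θ θ₁ : ℝ → ℝ) (t x y : ℝ) : ℝ :=
  mehlerFactor α t x y *
    (csch t * y * θ₁ (csch t * (x * y)) - mehlerExpX t x y * θ (csch t * (x * y)))

/-- The `∂_x`-derivative of `factorTAux`. -/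
def factorTXAux (α : ℝ) (θ θ₁ θ₂ : ℝ → ℝ) (t x y : ℝ) : ℝ :=
  -(2 * coth t * (1 + α) * (csch t * y * θ₁ (csch t * (x * y)))) -
    2 * coth t * (csch t * y * θ₁ (csch t * (x * y)) +
      (csch t * (x * y)) * (csch t * y * θ₂ (csch t * (x * y)))) -
    (2 * csch t * mehlerExpX t y x * θ (csch t * (x * y)) +
      mehlerExpT t x y * (csch t * y * θ₁ (csch t * (x * y))))

/-- The `∂_x ∂_t`-derivative of the one-dimensional kernel. -/
def factorTX (α : ℝ) (θ θ₁ θ₂ : ℝ → ℝ) (t x y : ℝ) : ℝ :=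
  mehlerFactor α t x y * (factorTXAux α θ θ₁ θ₂ t x y -
    mehlerExpX t x y * factorTAux α θ θ₁ t x y)

section Derivatives

variable {α : ℝ} {θ θ₁ θ₂ : ℝ → ℝ} {t : ℝ}

lemma sinh_two_mul_pos (ht : 0 < t) : 0 < Real.sinh (2 * t) := Real.sinh_pos_iff.2 (by linarith)

lemma csch_pos (ht : 0 < t) : 0 < csch t := inv_pos.2 (sinh_two_mul_pos ht)

lemma hasDerivAt_sinh_two_mul (t : ℝ) :
    HasDerivAt (fun t => Real.sinh (2 * t)) (2 * Real.cosh (2 * t)) t :=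
  (((hasDerivAt_id' t).const_mul 2).sinh).congr_deriv (by ring)

lemma hasDerivAt_csch (ht : 0 < t) : HasDerivAt csch (-(2 * csch t * coth t)) t := by
  have hs := (sinh_two_mul_pos ht).ne'
  refine ((hasDerivAt_sinh_two_mul t).fun_inv hs).congr_deriv ?_
  rw [csch, coth]
  field_simp

lemma hasDerivAt_coth (ht : 0 < t) : HasDerivAt coth (-(2 * csch t ^ 2)) t := by
  have hs := (sinh_two_mul_pos ht).ne'
  have hc : HasDerivAt (fun t => Real.cosh (2 * t)) (2 * Real.sinh (2 * t)) t :=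
    (((hasDerivAt_id' t).const_mul 2).cosh).congr_deriv (by ring)
  refine (hc.fun_div (hasDerivAt_sinh_two_mul t) hs).congr_deriv ?_
  have := Real.cosh_sq (2 * t)
  rw [csch]
  field_simp
  rw [this]
  ring

lemma hasDerivAt_mehlerExp_time (ht : 0 < t) (x y : ℝ) :
    HasDerivAt (fun t => mehlerExp t x y) (mehlerExpT t x y) t := by
  refine ((((hasDerivAt_coth ht).div_const 2).mul_const (x ^ 2 + y ^ 2)).fun_sub
    ((hasDerivAt_csch ht).mul_const (x * y))).congr_deriv ?_
  rw [mehlerExpT]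
  ring

lemma hasDerivAt_mehlerFactor_time (ht : 0 < t) (x y : ℝ) :
    HasDerivAt (fun t => mehlerFactor α t x y)
      (mehlerFactor α t x y * (-(2 * coth t * (1 + α)) - mehlerExpT t x y)) t := by
  have hk := csch_pos ht
  refine ((((hasDerivAt_csch ht).rpow_const (p := 1 + α) (Or.inl hk.ne')).div_const 2).fun_mul
    (hasDerivAt_mehlerExp_time ht x y).fun_neg.exp).congr_deriv ?_
  have : csch t ^ (1 + α) = csch t ^ (1 + α - 1) * csch t := by
    rw [← Real.rpow_add_one hk.ne', sub_add_cancel]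
  rw [mehlerFactor, this]
  ring

lemma hasDerivAt_factor_time (h : ∀ z, HasDerivAt θ (θ₁ z) z) (ht : 0 < t) (x y : ℝ) :
    HasDerivAt (fun t => factor α θ t x y) (factorT α θ θ₁ t x y) t := by
  refine ((hasDerivAt_mehlerFactor_time ht x y).fun_mul
    ((h _).comp t ((hasDerivAt_csch ht).mul_const (x * y)))).congr_deriv ?_
  simp only [Function.comp]
  rw [factorT, factorTAux]
  ring

lemma hasDerivAt_mehlerExp_left (t x y : ℝ) :
    HasDerivAt (fun x => mehlerExp t x y) (mehlerExpX t x y) x := by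
  refine ((((hasDerivAt_pow 2 x).add_const (y ^ 2)).const_mul (coth t / 2)).fun_sub
    (((hasDerivAt_id' x).mul_const y).const_mul (csch t))).congr_deriv ?_
  rw [mehlerExpX]
  simp
  ring

lemma hasDerivAt_mehlerFactor_left (t x y : ℝ) :
    HasDerivAt (fun x => mehlerFactor α t x y)
      (mehlerFactor α t x y * -mehlerExpX t x y) x := by
  refine ((hasDerivAt_mehlerExp_left t x y).fun_neg.exp.const_mul
    (csch t ^ (1 + α) / 2)).congr_deriv ?_
  rw [mehlerFactor]
  ring

lemma hasDerivAt_comp_left (h : ∀ z, HasDerivAt θ (θ₁ z) z) (t x y : ℝ) :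
    HasDerivAt (fun x => θ (csch t * (x * y))) (csch t * y * θ₁ (csch t * (x * y))) x :=
  ((h _).comp x (((hasDerivAt_id' x).mul_const y).const_mul (csch t))).congr_deriv (by ring)

lemma hasDerivAt_factor_left (h : ∀ z, HasDerivAt θ (θ₁ z) z) (t x y : ℝ) :
    HasDerivAt (fun x => factor α θ t x y) (factorX α θ θ₁ t x y) x := by
  refine ((hasDerivAt_mehlerFactor_left t x y).fun_mul
    (hasDerivAt_comp_left h t x y)).congr_deriv ?_
  rw [factorX]
  ring

lemma hasDerivAt_factorT_left (h : ∀ z, HasDerivAt θ (θ₁ z) z) (h' : ∀ z, HasDerivAt θ₁ (θ₂ z) z)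
    (t x y : ℝ) :
    HasDerivAt (fun x => factorT α θ θ₁ t x y) (factorTX α θ θ₁ θ₂ t x y) x := by
  have hz : HasDerivAt (fun x => csch t * (x * y)) (csch t * y) x :=
    (((hasDerivAt_id' x).mul_const y).const_mul (csch t)).congr_deriv (by ring)
  have hQ : HasDerivAt (fun x => mehlerExpT t x y) (2 * csch t * mehlerExpX t y x) x := by
    refine ((((hasDerivAt_id' x).mul_const y).const_mul (2 * csch t * coth t)).fun_sub
      (((hasDerivAt_pow 2 x).add_const (y ^ 2)).const_mul (csch t ^ 2))).congr_deriv ?_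
    rw [mehlerExpX]
    simp
    ring
  have h0 := hasDerivAt_comp_left h t x y
  have h1 := hasDerivAt_comp_left h' t x y
  refine ((hasDerivAt_mehlerFactor_left t x y).fun_mul
    (((h0.const_mul (2 * coth t * (1 + α))).fun_neg.fun_sub
      ((hz.fun_mul h1).const_mul (2 * coth t))).fun_sub (hQ.fun_mul h0))).congr_deriv ?_
  rw [factorTX, factorTXAux, factorTAux]
  ring

lemma mehlerExp_comm (t x y : ℝ) : mehlerExp t x y = mehlerExp t y x := by
  rw [mehlerExp, mehlerExp]
  ring

lemma mehlerFactor_comm (α t x y : ℝ) : mehlerFactor α t x y = mehlerFactor α t y x := by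
  rw [mehlerFactor, mehlerFactor, mehlerExp_comm]

lemma factor_comm (α : ℝ) (θ : ℝ → ℝ) (t x y : ℝ) : factor α θ t x y = factor α θ t y x := by
  rw [factor, factor, mehlerFactor_comm, mul_comm x y]

lemma factorT_comm (α : ℝ) (θ θ₁ : ℝ → ℝ) (t x y : ℝ) :
    factorT α θ θ₁ t x y = factorT α θ θ₁ t y x := by
  rw [factorT, factorT, factorTAux, factorTAux, mehlerFactor_comm, mul_comm x y, mehlerExpT,
    mehlerExpT, mul_comm x y, add_comm (x ^ 2)]

/-- A differentiable function of two variables is differentiated by its partial derivatives. -/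
lemma hasFDerivAt_of_partials {f : ℝ → ℝ → ℝ} {x y a b : ℝ}
    (hf : DifferentiableAt ℝ (fun p : ℝ × ℝ => f p.1 p.2) (x, y))
    (hx : HasDerivAt (fun s => f s y) a x) (hy : HasDerivAt (fun s => f x s) b y) :
    HasFDerivAt (fun p : ℝ × ℝ => f p.1 p.2)
      (a • ContinuousLinearMap.fst ℝ ℝ ℝ + b • ContinuousLinearMap.snd ℝ ℝ ℝ) (x, y) := by
  have h := hf.hasFDerivAt
  have e1 : HasDerivAt (fun s => f s y) (fderiv ℝ (fun p : ℝ × ℝ => f p.1 p.2) (x, y) (1, 0)) x :=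
    h.comp_hasDerivAt (f := fun s => (s, y)) x ((hasDerivAt_id' x).prodMk (hasDerivAt_const x y))
  have e2 : HasDerivAt (fun s => f x s) (fderiv ℝ (fun p : ℝ × ℝ => f p.1 p.2) (x, y) (0, 1)) y :=
    h.comp_hasDerivAt (f := fun s => (x, s)) y ((hasDerivAt_const y x).prodMk (hasDerivAt_id' y))
  have h1 := e1.unique hx
  have h2 := e2.unique hy
  refine h.congr_fderiv ?_
  ext <;> simp [h1, h2]

lemma hasFDerivAt_factor (h : ∀ z, HasDerivAt θ (θ₁ z) z) (t x y : ℝ) :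
    HasFDerivAt (fun p : ℝ × ℝ => factor α θ t p.1 p.2)
      (factorX α θ θ₁ t x y • ContinuousLinearMap.fst ℝ ℝ ℝ +
        factorX α θ θ₁ t y x • ContinuousLinearMap.snd ℝ ℝ ℝ) (x, y) := by
  refine hasFDerivAt_of_partials ?_ (hasDerivAt_factor_left h t x y) ?_
  · have : Differentiable ℝ θ := fun z => (h z).differentiableAt
    unfold factor mehlerFactor mehlerExp
    fun_prop
  · simp only [factor_comm α θ t x]
    exact hasDerivAt_factor_left h t y x

lemma hasFDerivAt_factorT (h : ∀ z, HasDerivAt θ (θ₁ z) z) (h' : ∀ z, HasDerivAt θ₁ (θ₂ z) z)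
    (t x y : ℝ) :
    HasFDerivAt (fun p : ℝ × ℝ => factorT α θ θ₁ t p.1 p.2)
      (factorTX α θ θ₁ θ₂ t x y • ContinuousLinearMap.fst ℝ ℝ ℝ +
        factorTX α θ θ₁ θ₂ t y x • ContinuousLinearMap.snd ℝ ℝ ℝ) (x, y) := by
  refine hasFDerivAt_of_partials ?_ (hasDerivAt_factorT_left h h' t x y) ?_
  · have : Differentiable ℝ θ := fun z => (h z).differentiableAt
    have : Differentiable ℝ θ₁ := fun z => (h' z).differentiableAt
    unfold factorT factorTAux mehlerFactor mehlerExp mehlerExpT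
    fun_prop
  · simp only [factorT_comm α θ θ₁ t x]
    exact hasDerivAt_factorT_left h h' t y x

lemma continuousOn_csch : ContinuousOn csch (Ioi 0) := fun _ ht =>
  (hasDerivAt_csch ht).continuousAt.continuousWithinAt

lemma continuousOn_coth : ContinuousOn coth (Ioi 0) := fun _ ht =>
  (hasDerivAt_coth ht).continuousAt.continuousWithinAt

lemma continuousOn_mehlerFactor (α x y : ℝ) :
    ContinuousOn (fun t => mehlerFactor α t x y) (Ioi 0) := fun _ ht =>
  (hasDerivAt_mehlerFactor_time ht x y).continuousAt.continuousWithinAt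

lemma continuousOn_factor_family (h : IsSymbol (α + 1 / 2) θ θ₁ θ₂) (x y : ℝ) :
    ContinuousOn (fun t => factor α θ t x y) (Ioi 0) ∧
    ContinuousOn (fun t => factorT α θ θ₁ t x y) (Ioi 0) ∧
    ContinuousOn (fun t => factorX α θ θ₁ t x y) (Ioi 0) ∧
    ContinuousOn (fun t => factorTX α θ θ₁ θ₂ t x y) (Ioi 0) := by
  have hk := continuousOn_csch
  have hh := continuousOn_coth
  have hm := continuousOn_mehlerFactor α x y
  have c0 : Continuous θ := continuous_iff_continuousAt.2 fun z => (h.hasDerivAt z).continuousAt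
  have c1 : Continuous θ₁ := continuous_iff_continuousAt.2 fun z => (h.hasDerivAt' z).continuousAt
  have c2 := h.continuous
  have e0 : ContinuousOn (fun t => θ (csch t * (x * y))) (Ioi 0) :=
    c0.comp_continuousOn (hk.mul continuousOn_const)
  have e1 : ContinuousOn (fun t => θ₁ (csch t * (x * y))) (Ioi 0) :=
    c1.comp_continuousOn (hk.mul continuousOn_const)
  have e2 : ContinuousOn (fun t => θ₂ (csch t * (x * y))) (Ioi 0) :=
    c2.comp_continuousOn (hk.mul continuousOn_const)
  unfold factor factorT factorX factorTX factorTXAux factorTAux mehlerExpT mehlerExpX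
  refine ⟨by fun_prop, by fun_prop, by fun_prop, by fun_prop⟩

end Derivatives

/-! ### Pointwise bounds in one dimension -/

/-- `√(1/tanh t)`, the reciprocal square root of the time variable `tanh t`. -/
def invSqrtTanh (t : ℝ) : ℝ := √(Real.tanh t)⁻¹

/-- The common majorant of the one-dimensional kernel and its derivatives, up to powers
of `tanh t`. -/
def majorant (a t x y : ℝ) : ℝ :=
  Real.exp (-(2 * t * (a + 1 / 2))) * (invSqrtTanh t * (Real.tanh t + x ^ 2) ^ (-a) *
    Real.exp (-((x - y) ^ 2 / (8 * Real.tanh t))))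

section Bounds

variable {t : ℝ}

lemma tanh_mem (ht : 0 < t) : 0 < Real.tanh t ∧ Real.tanh t < 1 := by
  refine ⟨?_, Real.tanh_lt_one t⟩
  rw [Real.tanh_eq_sinh_div_cosh]
  exact div_pos (Real.sinh_pos_iff.2 ht) (Real.cosh_pos t)

lemma csch_eq (ht : 0 < t) : csch t = (1 - Real.tanh t ^ 2) / (2 * Real.tanh t) := by
  have hc := (Real.cosh_pos t).ne'
  have hs := (Real.sinh_pos_iff.2 ht).ne'
  rw [csch, Real.sinh_two_mul, Real.tanh_eq_sinh_div_cosh]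
  have := Real.cosh_sq t
  field_simp
  linarith

lemma coth_eq (ht : 0 < t) : coth t = (1 + Real.tanh t ^ 2) / (2 * Real.tanh t) := by
  have hc := (Real.cosh_pos t).ne'
  have hs := (Real.sinh_pos_iff.2 ht).ne'
  rw [coth, Real.sinh_two_mul, Real.cosh_two_mul, Real.tanh_eq_sinh_div_cosh]
  field_simp

lemma mehlerExp_eq (ht : 0 < t) (x y : ℝ) : mehlerExp t x y =
    (x - y) ^ 2 / (4 * Real.tanh t) + Real.tanh t * (x + y) ^ 2 / 4 := by
  have h := (tanh_mem ht).1
  rw [mehlerExp, csch_eq ht, coth_eq ht]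
  field_simp
  ring

lemma mehlerExp_nonneg (ht : 0 < t) (x y : ℝ) : 0 ≤ mehlerExp t x y := by
  have h := (tanh_mem ht).1
  rw [mehlerExp_eq ht]
  positivity

lemma invSqrtTanh_pos (ht : 0 < t) : 0 < invSqrtTanh t :=
  Real.sqrt_pos.2 (inv_pos.2 (tanh_mem ht).1)

lemma invSqrtTanh_sq (ht : 0 < t) : invSqrtTanh t ^ 2 = (Real.tanh t)⁻¹ :=
  Real.sq_sqrt (inv_pos.2 (tanh_mem ht).1).le

lemma coth_le (ht : 0 < t) : 0 ≤ coth t ∧ coth t ≤ invSqrtTanh t ^ 2 := by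
  obtain ⟨h0, h1⟩ := tanh_mem ht
  rw [coth_eq ht, invSqrtTanh_sq ht, ← one_div, div_le_div_iff₀ (by positivity) h0]
  exact ⟨by positivity, by nlinarith⟩

lemma csch_le (ht : 0 < t) : 2 * csch t ≤ invSqrtTanh t ^ 2 := by
  obtain ⟨h0, h1⟩ := tanh_mem ht
  rw [csch_eq ht, invSqrtTanh_sq ht, ← one_div, mul_div_assoc', div_le_div_iff₀ (by positivity) h0]
  nlinarith [pow_pos h0 3]

lemma abs_mehlerExpT_le (ht : 0 < t) (x y : ℝ) :
    |mehlerExpT t x y| ≤ invSqrtTanh t ^ 2 * mehlerExp t x y := by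
  obtain ⟨h0, h1⟩ := tanh_mem ht
  have e : mehlerExpT t x y = (1 - Real.tanh t ^ 2) *
      ((x + y) ^ 2 / 4 - (x - y) ^ 2 / (4 * Real.tanh t ^ 2)) := by
    rw [mehlerExpT, csch_eq ht, coth_eq ht]
    field_simp
    ring
  have e2 : invSqrtTanh t ^ 2 * mehlerExp t x y =
      (x + y) ^ 2 / 4 + (x - y) ^ 2 / (4 * Real.tanh t ^ 2) := by
    rw [invSqrtTanh_sq ht, mehlerExp_eq ht]
    field_simp
    ring
  have h2 : 0 ≤ 1 - Real.tanh t ^ 2 := by nlinarith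
  have p1 : 0 ≤ (x + y) ^ 2 / 4 := by positivity
  have p2 : 0 ≤ (x - y) ^ 2 / (4 * Real.tanh t ^ 2) := by positivity
  rw [e, e2, abs_mul, abs_of_nonneg h2]
  calc _ ≤ 1 * |(x + y) ^ 2 / 4 - (x - y) ^ 2 / (4 * Real.tanh t ^ 2)| := by
        gcongr
        nlinarith
    _ ≤ _ := by
        rw [one_mul, abs_le]
        constructor <;> linarith

lemma abs_mehlerExpX_le (ht : 0 < t) (x y : ℝ) :
    |mehlerExpX t x y| ≤ invSqrtTanh t * (1 + mehlerExp t x y) := by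
  obtain ⟨h0, h1⟩ := tanh_mem ht
  have hQ := mehlerExp_nonneg ht x y
  have hρ := invSqrtTanh_pos ht
  have e : mehlerExpX t x y = (x - y) / (2 * Real.tanh t) + Real.tanh t * (x + y) / 2 := by
    rw [mehlerExpX, csch_eq ht, coth_eq ht]
    field_simp
    ring
  have key : mehlerExpX t x y ^ 2 ≤ invSqrtTanh t ^ 2 * (2 * mehlerExp t x y) := by
    have e2 : invSqrtTanh t ^ 2 * (2 * mehlerExp t x y) =
        2 * ((x - y) / (2 * Real.tanh t)) ^ 2 + (x + y) ^ 2 / 2 := by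
      rw [invSqrtTanh_sq ht, mehlerExp_eq ht]
      field_simp
      ring
    have h3 : (Real.tanh t * (x + y) / 2) ^ 2 ≤ (x + y) ^ 2 / 4 := by
      have : Real.tanh t ^ 2 ≤ 1 := by nlinarith
      nlinarith [sq_nonneg (x + y)]
    rw [e, e2]
    nlinarith [sq_nonneg ((x - y) / (2 * Real.tanh t) - Real.tanh t * (x + y) / 2)]
  refine abs_le_of_sq_le_sq ?_ (by positivity)
  rw [mul_pow]
  refine key.trans ?_
  gcongr
  nlinarith

lemma csch_mul_sub_sq_le (ht : 0 < t) (x y : ℝ) :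
    csch t * (x - y) ^ 2 ≤ 2 * mehlerExp t x y := by
  obtain ⟨h0, h1⟩ := tanh_mem ht
  rw [csch_eq ht, mehlerExp_eq ht]
  have h2 : 0 ≤ Real.tanh t * (x + y) ^ 2 / 4 := by positivity
  have : (1 - Real.tanh t ^ 2) / (2 * Real.tanh t) * (x - y) ^ 2 ≤
      2 * ((x - y) ^ 2 / (4 * Real.tanh t)) := by
    have : 2 * ((x - y) ^ 2 / (4 * Real.tanh t)) = 1 / (2 * Real.tanh t) * (x - y) ^ 2 := by
      field_simp
      ring
    rw [this]
    gcongr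
    nlinarith
  linarith

/-- The factor `y / sinh 2t` produced by differentiating in `x` costs one power of
`(tanh t)^(-1/2)` and one power of `1 + xy / sinh 2t`; the latter is gained back
from the symbol. -/
lemma csch_mul_le (ht : 0 < t) {x y : ℝ} (hx : 0 < x) (hy : 0 < y) :
    csch t * y ≤ invSqrtTanh t * (1 + csch t * (x * y)) * (1 + mehlerExp t x y) := by
  have hκ := csch_pos ht
  have hρ := invSqrtTanh_pos ht
  have hQ := mehlerExp_nonneg ht x y
  have h1 := csch_mul_sub_sq_le ht x y
  have h2 := csch_le ht
  have hz : 0 < csch t * (x * y) := by positivity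
  have h3 : csch t * y ^ 2 ≤ 2 * (csch t * (x * y)) + 2 * mehlerExp t x y := by
    have : csch t * y ^ 2 ≤ csch t * (2 * (x * y) + (x - y) ^ 2) := by
      gcongr
      nlinarith
    linarith
  set z := csch t * (x * y)
  set Q := mehlerExp t x y
  refine le_of_sq_le_sq ?_ (by positivity)
  calc (csch t * y) ^ 2 = csch t * (csch t * y ^ 2) := by ring
    _ ≤ csch t * (2 * z + 2 * Q) := by gcongr
    _ = (2 * csch t) * (z + Q) := by ring
    _ ≤ invSqrtTanh t ^ 2 * (z + Q) := by gcongr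
    _ ≤ invSqrtTanh t ^ 2 * (((1 + z) * (1 + Q)) * ((1 + z) * (1 + Q))) := by
        gcongr
        have : z + Q ≤ (1 + z) * (1 + Q) := by nlinarith
        have h1 : 1 ≤ (1 + z) * (1 + Q) := by nlinarith
        nlinarith
    _ = _ := by ring

/-- This compares the weight of the kernel, which involves `xy / sinh 2t`, with the weight of the
measure, which involves `x²` only. -/
lemma tanh_add_sq_le (ht : 0 < t) {x y : ℝ} (hx : 0 < x) (hy : 0 < y) :
    Real.tanh t + x ^ 2 ≤
      4 * Real.tanh t * (1 + csch t * (x * y)) * (1 + mehlerExp t x y) := by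
  obtain ⟨h0, h1⟩ := tanh_mem ht
  have hκ := csch_pos ht
  have hz : 0 < csch t * (x * y) := by positivity
  have hQ := mehlerExp_nonneg ht x y
  have e1 : Real.tanh t * (csch t * (x * y)) = (1 - Real.tanh t ^ 2) * (x * y) / 2 := by
    rw [csch_eq ht]
    field_simp
  have e2 : Real.tanh t * mehlerExp t x y =
      (x - y) ^ 2 / 4 + Real.tanh t ^ 2 * (x + y) ^ 2 / 4 := by
    rw [mehlerExp_eq ht]
    field_simp
  have e3 : 0 ≤ Real.tanh t * (csch t * (x * y)) * mehlerExp t x y := by positivity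
  have e4 : x ^ 2 ≤ 2 * (x * y) + (x - y) ^ 2 := by nlinarith
  have e5 : Real.tanh t ^ 2 * (2 * (x * y)) ≤ Real.tanh t ^ 2 * (x + y) ^ 2 := by
    gcongr
    nlinarith
  nlinarith

lemma csch_le_exp (ht : 0 < t) : csch t ≤ 2 / Real.tanh t * Real.exp (-(2 * t)) := by
  have hc := Real.cosh_pos t
  have hs := Real.sinh_pos_iff.2 ht
  rw [csch, Real.sinh_two_mul, Real.tanh_eq_sinh_div_cosh, Real.exp_neg, div_div_eq_mul_div,
    ← div_eq_mul_inv, inv_eq_one_div, div_le_div_iff₀ (by positivity) (by positivity)]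
  have : Real.exp (2 * t) = Real.exp t ^ 2 := by rw [← Real.exp_nat_mul]; norm_num
  have h2 : Real.exp (t) ≤ 2 * Real.cosh t := by
    rw [Real.cosh_eq]
    linarith [Real.exp_pos (-t)]
  have h3 : Real.exp (2 * t) ≤ (2 * Real.cosh t) ^ 2 := by
    rw [this]
    gcongr
  rw [one_mul]
  refine h3.trans_eq ?_
  field_simp

/-- Polynomials are dominated by exponentials: `(1+q)^N e^{-cq}` is bounded on `q ≥ 0`. -/
lemma exists_one_add_rpow_mul_exp_le (N : ℝ) {c : ℝ} (hc : 0 < c) :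
    ∃ C, 0 < C ∧ ∀ q, 0 ≤ q → (1 + q) ^ N * Real.exp (-(c * q)) ≤ C := by
  have h := tendsto_rpow_mul_exp_neg_mul_atTop_nhds_zero N c hc
  have h' : Filter.Tendsto (fun q : ℝ => (1 + q) ^ N * Real.exp (-c * (1 + q))) Filter.atTop
      (nhds 0) := h.comp (Filter.tendsto_atTop_add_const_left _ 1 Filter.tendsto_id)
  obtain ⟨R, hR⟩ := Filter.eventually_atTop.1 (h'.eventually (gt_mem_nhds one_pos))
  have hcont : ContinuousOn (fun q : ℝ => (1 + q) ^ N * Real.exp (-c * (1 + q)))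
      (Icc 0 (max R 0)) := by
    refine ContinuousOn.mul (ContinuousOn.rpow_const (by fun_prop) fun q hq => ?_) (by fun_prop)
    exact Or.inl (by linarith [hq.1])
  obtain ⟨M, hM⟩ := (isCompact_Icc.image_of_continuousOn hcont).bddAbove
  refine ⟨Real.exp c * max M 1, by positivity, fun q hq => ?_⟩
  have e : (1 + q) ^ N * Real.exp (-(c * q)) =
      Real.exp c * ((1 + q) ^ N * Real.exp (-c * (1 + q))) := by
    rw [show -(c * q) = c + -c * (1 + q) by ring, Real.exp_add]
    ring
  rw [e]
  gcongr
  rcases le_total q R with h | h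
  · exact (hM ⟨q, ⟨hq, h.trans (le_max_left _ _)⟩, rfl⟩).trans (le_max_left _ _)
  · exact (hR q h).le.trans (le_max_right _ _)

lemma exists_mehlerFactor_le {α : ℝ} (hα : -(1 / 2) ≤ α) :
    ∃ C, 0 < C ∧ ∀ t, 0 < t → ∀ x y, 0 < x → 0 < y →
      mehlerFactor α t x y * (1 + csch t * (x * y)) ^ (-(α + 1 / 2)) * (1 + mehlerExp t x y) ^ 2 ≤
        C * majorant (α + 1 / 2) t x y := by
  obtain ⟨C, hC0, hC⟩ := exists_one_add_rpow_mul_exp_le (α + 1 / 2 + 2) (c := 1 / 2) (by norm_num)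
  refine ⟨2 ^ (1 + α) * 4 ^ (α + 1 / 2) * C, by positivity, fun t ht x y hx hy => ?_⟩
  obtain ⟨h0, h1⟩ := tanh_mem ht
  have hκ := csch_pos ht
  have hz : 0 < csch t * (x * y) := by positivity
  have hQ := mehlerExp_nonneg ht x y
  have hw := tanh_add_sq_le ht hx hy
  have hQ2 : (x - y) ^ 2 / (8 * Real.tanh t) ≤ 1 / 2 * mehlerExp t x y := by
    rw [mehlerExp_eq ht]
    have : 0 ≤ Real.tanh t * (x + y) ^ 2 / 4 := by positivity
    have e : (x - y) ^ 2 / (8 * Real.tanh t) = 1 / 2 * ((x - y) ^ 2 / (4 * Real.tanh t)) := by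
      ring
    rw [e]
    linarith
  have hk := csch_le_exp ht
  have hCQ := hC _ hQ
  set z := csch t * (x * y) with hzdef
  set Q := mehlerExp t x y with hQdef
  set τ := Real.tanh t with hτ
  have ha : 0 ≤ α + 1 / 2 := by linarith
  have b1 : csch t ^ (1 + α) ≤ 2 ^ (1 + α) * τ ^ (-(1 + α)) *
      Real.exp (-(2 * t * (α + 1 / 2 + 1 / 2))) := by
    calc csch t ^ (1 + α) ≤ (2 / τ * Real.exp (-(2 * t))) ^ (1 + α) := by
          gcongr
          linarith
      _ = _ := by
          rw [Real.mul_rpow (by positivity) (by positivity), Real.div_rpow zero_le_two h0.le,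
            ← Real.exp_mul, Real.rpow_neg h0.le, div_eq_mul_inv]
          ring_nf
  have b2 : (1 + z) ^ (-(α + 1 / 2)) ≤
      4 ^ (α + 1 / 2) * τ ^ (α + 1 / 2) * (1 + Q) ^ (α + 1 / 2) * (τ + x ^ 2) ^ (-(α + 1 / 2)) := by
    rw [Real.rpow_neg (by positivity), Real.rpow_neg (by positivity), ← div_eq_mul_inv,
      le_div_iff₀ (by positivity), inv_mul_le_iff₀ (by positivity),
      ← Real.mul_rpow (by positivity) (by positivity),
      ← Real.mul_rpow (by positivity) (by positivity),
      ← Real.mul_rpow (by positivity) (by positivity)]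
    gcongr
    linarith
  have b3 : τ ^ (-(1 + α)) * τ ^ (α + 1 / 2) = invSqrtTanh t := by
    rw [← Real.rpow_add h0, invSqrtTanh, Real.sqrt_eq_rpow, Real.inv_rpow h0.le,
      ← Real.rpow_neg h0.le]
    ring_nf
  have b4 : Real.exp (-(1 / 2 * Q)) ≤ Real.exp (-((x - y) ^ 2 / (8 * τ))) := by
    gcongr
  have b5 : (1 + Q) ^ (α + 1 / 2) * (1 + Q) ^ 2 = (1 + Q) ^ (α + 1 / 2 + 2) := by
    rw [Real.rpow_add (by positivity) (α + 1 / 2), Real.rpow_ofNat]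
  have b6 : Real.exp (-Q) = Real.exp (-(1 / 2 * Q)) * Real.exp (-(1 / 2 * Q)) := by
    rw [← Real.exp_add]
    ring_nf
  calc mehlerFactor α t x y * (1 + z) ^ (-(α + 1 / 2)) * (1 + Q) ^ 2
      ≤ (2 ^ (1 + α) * τ ^ (-(1 + α)) * Real.exp (-(2 * t * (α + 1 / 2 + 1 / 2)))) *
        Real.exp (-Q) * (4 ^ (α + 1 / 2) * τ ^ (α + 1 / 2) * (1 + Q) ^ (α + 1 / 2) *
          (τ + x ^ 2) ^ (-(α + 1 / 2))) * (1 + Q) ^ 2 := by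
        rw [mehlerFactor, ← hQdef]
        gcongr
        refine le_trans ?_ b1
        have : 0 ≤ csch t ^ (1 + α) := by positivity
        linarith
    _ = 2 ^ (1 + α) * 4 ^ (α + 1 / 2) * ((1 + Q) ^ (α + 1 / 2 + 2) * Real.exp (-(1 / 2 * Q))) *
        (Real.exp (-(2 * t * (α + 1 / 2 + 1 / 2))) * (invSqrtTanh t *
          (τ + x ^ 2) ^ (-(α + 1 / 2)) * Real.exp (-(1 / 2 * Q)))) := by
        rw [b6, ← b5, ← b3]
        ring
    _ ≤ 2 ^ (1 + α) * 4 ^ (α + 1 / 2) * C *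
        (Real.exp (-(2 * t * (α + 1 / 2 + 1 / 2))) * (invSqrtTanh t *
          (τ + x ^ 2) ^ (-(α + 1 / 2)) * Real.exp (-((x - y) ^ 2 / (8 * τ))))) := by
        have := (invSqrtTanh_pos ht).le
        gcongr
    _ = _ := by rw [majorant]

lemma abs_factorAux_le {α : ℝ} (hα : -(1 / 2) ≤ α) {θ θ₁ θ₂ : ℝ → ℝ} {K : ℝ} (hK0 : 0 ≤ K)
    (hK : ∀ z, 0 ≤ z → |θ z| ≤ K * (1 + z) ^ (-(α + 1 / 2)) ∧
      |θ₁ z| ≤ K * (1 + z) ^ (-(α + 1 / 2) - 1) ∧ |θ₂ z| ≤ K * (1 + z) ^ (-(α + 1 / 2) - 2))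
    (ht : 0 < t) {x y : ℝ} (hx : 0 < x) (hy : 0 < y) :
    |factorTAux α θ θ₁ t x y| ≤ (2 * α + 5) * (K *
      (1 + csch t * (x * y)) ^ (-(α + 1 / 2)) * invSqrtTanh t ^ 2 * (1 + mehlerExp t x y)) ∧
    |csch t * y * θ₁ (csch t * (x * y))| ≤ K * (1 + csch t * (x * y)) ^ (-(α + 1 / 2)) *
      (invSqrtTanh t * (1 + mehlerExp t x y)) ∧
    |factorTXAux α θ θ₁ θ₂ t x y| ≤ (2 * α + 8) * (K *
      (1 + csch t * (x * y)) ^ (-(α + 1 / 2)) * invSqrtTanh t ^ 3 *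
        (1 + mehlerExp t x y) ^ 2) := by
  have hκ := csch_pos ht
  have hρ := invSqrtTanh_pos ht
  have hz : 0 < csch t * (x * y) := by positivity
  have hQ := mehlerExp_nonneg ht x y
  obtain ⟨k0, k1, k2⟩ := hK _ hz.le
  have hy1 := csch_mul_le ht hx hy
  have hT := abs_mehlerExpT_le ht x y
  have hY := abs_mehlerExpX_le ht y x
  rw [mehlerExp_comm t y x] at hY
  obtain ⟨hh0, hh⟩ := coth_le ht
  have hκ2 := csch_le ht
  rw [factorTAux, factorTXAux]
  set z := csch t * (x * y)
  set Q := mehlerExp t x y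
  set ρ := invSqrtTanh t
  set T := (1 + z) ^ (-(α + 1 / 2)) with hTdef
  have hz1 : 0 < 1 + z := by linarith
  have hTpos : 0 < T := by positivity
  have hT1 : (1 + z) * (1 + z) ^ (-(α + 1 / 2) - 1) = T := by
    rw [mul_comm, ← Real.rpow_add_one hz1.ne', sub_add_cancel]
  have hT2 : (1 + z) * ((1 + z) * (1 + z) ^ (-(α + 1 / 2) - 2)) = T := by
    rw [← hT1, show -(α + 1 / 2) - 1 = -(α + 1 / 2) - 2 + 1 by ring, Real.rpow_add_one hz1.ne']
    ring
  have m1 : (1 + z) * |θ₁ z| ≤ K * T := by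
    calc (1 + z) * |θ₁ z| ≤ (1 + z) * (K * (1 + z) ^ (-(α + 1 / 2) - 1)) := by gcongr
      _ = K * T := by rw [← hT1]; ring
  have m2 : (1 + z) * ((1 + z) * |θ₂ z|) ≤ K * T := by
    calc _ ≤ (1 + z) * ((1 + z) * (K * (1 + z) ^ (-(α + 1 / 2) - 2))) := by gcongr
      _ = K * T := by rw [← hT2]; ring
  have n1 : |z * θ₁ z| ≤ K * T := by
    rw [abs_mul, abs_of_pos hz]
    refine le_trans ?_ m1
    gcongr
    linarith
  have n2 : |csch t * y * θ₁ z| ≤ K * T * (ρ * (1 + Q)) := by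
    rw [abs_mul, abs_of_pos (by positivity : 0 < csch t * y)]
    calc _ ≤ ρ * (1 + z) * (1 + Q) * |θ₁ z| := by gcongr
      _ = ((1 + z) * |θ₁ z|) * (ρ * (1 + Q)) := by ring
      _ ≤ _ := by gcongr
  have n3 : |z * (csch t * y * θ₂ z)| ≤ K * T * (ρ * (1 + Q)) := by
    rw [abs_mul z, abs_mul (csch t * y), abs_of_pos hz,
      abs_of_pos (by positivity : 0 < csch t * y)]
    calc _ ≤ (1 + z) * (ρ * (1 + z) * (1 + Q) * |θ₂ z|) := by
          gcongr
          linarith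
      _ = ((1 + z) * ((1 + z) * |θ₂ z|)) * (ρ * (1 + Q)) := by ring
      _ ≤ _ := by gcongr
  have hα1 : 0 ≤ 1 + α := by linarith
  have hKT : 0 ≤ K * T := by positivity
  have hq : 1 ≤ 1 + Q := by linarith
  refine ⟨?_, n2, ?_⟩
  · calc |-(2 * coth t * (1 + α) * θ z) - 2 * coth t * (z * θ₁ z) - mehlerExpT t x y * θ z|
        ≤ 2 * coth t * (1 + α) * |θ z| + 2 * coth t * |z * θ₁ z| +
          |mehlerExpT t x y| * |θ z| := by
          refine (abs_sub _ _).trans ?_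
          rw [abs_mul (mehlerExpT t x y)]
          gcongr
          refine (abs_sub _ _).trans ?_
          rw [abs_neg, abs_mul _ (θ z), abs_mul _ (z * θ₁ z),
            abs_of_nonneg (by positivity : 0 ≤ 2 * coth t * (1 + α)),
            abs_of_nonneg (by positivity : 0 ≤ 2 * coth t)]
      _ ≤ 2 * ρ ^ 2 * (1 + α) * (K * T) + 2 * ρ ^ 2 * (K * T) + ρ ^ 2 * Q * (K * T) := by
          gcongr
      _ ≤ 2 * ρ ^ 2 * (1 + α) * (K * T) * (1 + Q) + 2 * ρ ^ 2 * (K * T) * (1 + Q) +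
          ρ ^ 2 * (1 + Q) * (K * T) := by
          refine add_le_add (add_le_add ?_ ?_) ?_
          · exact le_mul_of_one_le_right (by positivity) hq
          · exact le_mul_of_one_le_right (by positivity) hq
          · gcongr
            linarith
      _ = _ := by ring
  · calc _ ≤ 2 * coth t * (1 + α) * |csch t * y * θ₁ z| + 2 * coth t *
          (|csch t * y * θ₁ z| + |z * (csch t * y * θ₂ z)|) +
          (2 * csch t * |mehlerExpX t y x| * |θ z| +
            |mehlerExpT t x y| * |csch t * y * θ₁ z|) := by
          refine (abs_sub _ _).trans ?_
          refine add_le_add ((abs_sub _ _).trans (add_le_add ?_ ?_))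
            ((abs_add_le _ _).trans (add_le_add ?_ ?_))
          · rw [abs_neg, abs_mul, abs_of_nonneg (by positivity : 0 ≤ 2 * coth t * (1 + α))]
          · rw [abs_mul, abs_of_nonneg (by positivity : 0 ≤ 2 * coth t)]
            gcongr
            exact abs_add_le _ _
          · rw [abs_mul, abs_mul, abs_of_nonneg (by positivity : 0 ≤ 2 * csch t)]
          · rw [abs_mul]
      _ ≤ 2 * ρ ^ 2 * (1 + α) * (K * T * (ρ * (1 + Q))) + 2 * ρ ^ 2 *
          (K * T * (ρ * (1 + Q)) + K * T * (ρ * (1 + Q))) +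
          (ρ ^ 2 * (ρ * (1 + Q)) * (K * T) + ρ ^ 2 * Q * (K * T * (ρ * (1 + Q)))) := by
          gcongr
      _ = K * T * ρ ^ 3 * (1 + Q) * (2 * α + 7 + Q) := by ring
      _ ≤ K * T * ρ ^ 3 * (1 + Q) * ((2 * α + 8) * (1 + Q)) := by
          gcongr
          nlinarith
      _ = _ := by ring

/-- Each time derivative of the one-dimensional kernel costs a factor `1/tanh t`, each space
derivative a factor `(1/tanh t)^(1/2)`. The bounds hold for the derivatives in `y` as well, because
the intermediate majorant is symmetric in `x` and `y`. -/
lemma exists_factor_family_le {α : ℝ} (hα : -(1 / 2) ≤ α) {θ θ₁ θ₂ : ℝ → ℝ}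
    (h : IsSymbol (α + 1 / 2) θ θ₁ θ₂) :
    ∃ C, ∀ t, 0 < t → ∀ x y, 0 < x → 0 < y →
      |factor α θ t x y| ≤ C * majorant (α + 1 / 2) t x y ∧
      |factorT α θ θ₁ t x y| ≤ C * (invSqrtTanh t ^ 2 * majorant (α + 1 / 2) t x y) ∧
      |factorX α θ θ₁ t x y| ≤ C * (invSqrtTanh t * majorant (α + 1 / 2) t x y) ∧
      |factorX α θ θ₁ t y x| ≤ C * (invSqrtTanh t * majorant (α + 1 / 2) t x y) ∧
      |factorTX α θ θ₁ θ₂ t x y| ≤ C * (invSqrtTanh t ^ 3 * majorant (α + 1 / 2) t x y) ∧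
      |factorTX α θ θ₁ θ₂ t y x| ≤ C * (invSqrtTanh t ^ 3 * majorant (α + 1 / 2) t x y) := by
  obtain ⟨K, hK⟩ := h.bound
  have hK0 : 0 ≤ K := by simpa using (abs_nonneg _).trans (hK 0 le_rfl).1
  obtain ⟨C, hC0, hC⟩ := exists_mehlerFactor_le hα
  have main : ∀ t, 0 < t → ∀ x y, 0 < x → 0 < y →
      |factor α θ t x y| ≤ (4 * α + 13) * K * (mehlerFactor α t x y *
        (1 + csch t * (x * y)) ^ (-(α + 1 / 2)) * (1 + mehlerExp t x y) ^ 2) ∧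
      |factorT α θ θ₁ t x y| ≤ (4 * α + 13) * K * (invSqrtTanh t ^ 2 * (mehlerFactor α t x y *
        (1 + csch t * (x * y)) ^ (-(α + 1 / 2)) * (1 + mehlerExp t x y) ^ 2)) ∧
      |factorX α θ θ₁ t x y| ≤ (4 * α + 13) * K * (invSqrtTanh t * (mehlerFactor α t x y *
        (1 + csch t * (x * y)) ^ (-(α + 1 / 2)) * (1 + mehlerExp t x y) ^ 2)) ∧
      |factorTX α θ θ₁ θ₂ t x y| ≤ (4 * α + 13) * K * (invSqrtTanh t ^ 3 *
        (mehlerFactor α t x y * (1 + csch t * (x * y)) ^ (-(α + 1 / 2)) *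
          (1 + mehlerExp t x y) ^ 2)) := by
    intro t ht x y hx hy
    have hκ := csch_pos ht
    have hρ := invSqrtTanh_pos ht
    have hz : 0 < csch t * (x * y) := by positivity
    have hQ := mehlerExp_nonneg ht x y
    obtain ⟨k0, -, -⟩ := hK _ hz.le
    have hX := abs_mehlerExpX_le ht x y
    have hE : 0 ≤ mehlerFactor α t x y := by rw [mehlerFactor]; positivity
    rw [factor, factorT, factorX, factorTX]
    set E := mehlerFactor α t x y
    obtain ⟨hL0, hθ, hLX⟩ := abs_factorAux_le hα hK0 hK ht hx hy
    set z := csch t * (x * y)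
    set Q := mehlerExp t x y
    set ρ := invSqrtTanh t
    set T := (1 + z) ^ (-(α + 1 / 2)) with hTdef
    have hTpos : 0 < T := by positivity
    have hq : 1 ≤ 1 + Q := by linarith
    have hq2 : 1 + Q ≤ (1 + Q) ^ 2 := by nlinarith
    have hc : 0 ≤ (4 * α + 13) * K := mul_nonneg (by linarith) hK0
    refine ⟨?_, ?_, ?_, ?_⟩
    · rw [abs_mul, abs_of_nonneg hE]
      calc E * |θ z| ≤ E * (K * T) := by gcongr
        _ = 1 * K * (E * T * 1) := by ring
        _ ≤ (4 * α + 13) * K * (E * T * (1 + Q) ^ 2) := by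
            refine mul_le_mul (mul_le_mul_of_nonneg_right (by linarith) hK0) ?_ (by positivity) hc
            gcongr
            linarith
    · rw [abs_mul, abs_of_nonneg hE]
      calc _ ≤ E * ((2 * α + 5) * (K * T * ρ ^ 2 * (1 + Q))) := by gcongr
        _ = (2 * α + 5) * K * (ρ ^ 2 * (E * T * (1 + Q))) := by ring
        _ ≤ (4 * α + 13) * K * (ρ ^ 2 * (E * T * (1 + Q) ^ 2)) := by
            refine mul_le_mul (mul_le_mul_of_nonneg_right (by linarith) hK0) ?_ (by positivity) hc
            gcongr
    · rw [abs_mul, abs_of_nonneg hE]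
      calc _ ≤ E * (|csch t * y * θ₁ z| + |mehlerExpX t x y| * |θ z|) := by
            refine mul_le_mul_of_nonneg_left ((abs_sub _ _).trans_eq ?_) hE
            rw [abs_mul (mehlerExpX t x y)]
        _ ≤ E * (K * T * (ρ * (1 + Q)) + ρ * (1 + Q) * (K * T)) := by gcongr
        _ = 2 * K * (ρ * (E * T * (1 + Q))) := by ring
        _ ≤ (4 * α + 13) * K * (ρ * (E * T * (1 + Q) ^ 2)) := by
            refine mul_le_mul (mul_le_mul_of_nonneg_right (by linarith) hK0) ?_ (by positivity) hc
            gcongr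
    · rw [abs_mul, abs_of_nonneg hE]
      calc _ ≤ E * (|factorTXAux α θ θ₁ θ₂ t x y| + |mehlerExpX t x y| *
            |factorTAux α θ θ₁ t x y|) := by
            refine mul_le_mul_of_nonneg_left ((abs_sub _ _).trans_eq ?_) hE
            rw [abs_mul (mehlerExpX t x y)]
        _ ≤ E * ((2 * α + 8) * (K * T * ρ ^ 3 * (1 + Q) ^ 2) +
            ρ * (1 + Q) * ((2 * α + 5) * (K * T * ρ ^ 2 * (1 + Q)))) := by gcongr
        _ = _ := by ring
  have hα1 : 0 ≤ (4 * α + 13) * K := mul_nonneg (by linarith) hK0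
  refine ⟨(4 * α + 13) * K * C, fun t ht x y hx hy => ?_⟩
  obtain ⟨m0, mT, mX, mTX⟩ := main t ht x y hx hy
  obtain ⟨-, -, mY, mTY⟩ := main t ht y x hy hx
  rw [mehlerFactor_comm, mul_comm y x, mehlerExp_comm] at mY mTY
  have hC' := hC t ht x y hx hy
  have hρ := invSqrtTanh_pos ht
  have conv (r : ℝ) (hr : 0 ≤ r) : (4 * α + 13) * K * (r * (mehlerFactor α t x y *
      (1 + csch t * (x * y)) ^ (-(α + 1 / 2)) * (1 + mehlerExp t x y) ^ 2)) ≤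
      (4 * α + 13) * K * C * (r * majorant (α + 1 / 2) t x y) := by
    calc _ ≤ (4 * α + 13) * K * (r * (C * majorant (α + 1 / 2) t x y)) := by gcongr
      _ = _ := by ring
  refine ⟨m0.trans ?_, mT.trans (conv _ (by positivity)), mX.trans (conv _ hρ.le),
    mY.trans (conv _ hρ.le), mTX.trans (conv _ (by positivity)), mTY.trans (conv _ (by positivity))⟩
  simpa using conv 1 zero_le_one

end Bounds

/-! ### Products of one-dimensional kernels -/

section LeibnizBounds

variable {ι V : Type*} [DecidableEq ι] [NormedAddCommGroup V] [NormedSpace ℝ V]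

lemma prod_erase_mul_le {s : Finset ι} {f b : ι → ℝ} (hf : ∀ i ∈ s, |f i| ≤ b i) {i : ι}
    (hi : i ∈ s) {r c : ℝ} (hr : 0 ≤ r) (hc : c ≤ r * b i) :
    |∏ j ∈ s.erase i, f j| * c ≤ r * ∏ j ∈ s, b j := by
  have h0 : |∏ j ∈ s.erase i, f j| ≤ ∏ j ∈ s.erase i, b j := by
    rw [Finset.abs_prod]
    exact Finset.prod_le_prod (fun _ _ => abs_nonneg _)
      fun j hj => hf j (Finset.mem_of_mem_erase hj)
  have hb : 0 ≤ b i := (abs_nonneg _).trans (hf i hi)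
  calc _ ≤ |∏ j ∈ s.erase i, f j| * (r * b i) := by gcongr
    _ ≤ (∏ j ∈ s.erase i, b j) * (r * b i) := by gcongr
    _ = r * ((∏ j ∈ s.erase i, b j) * b i) := by ring
    _ = _ := by rw [Finset.prod_erase_mul _ _ hi]

lemma norm_sum_prod_erase_smul_le {s : Finset ι} {f b : ι → ℝ} {v : ι → V} {r : ℝ} (hr : 0 ≤ r)
    (hf : ∀ i ∈ s, |f i| ≤ b i) (hv : ∀ i ∈ s, ‖v i‖ ≤ r * b i) :
    ‖∑ i ∈ s, (∏ j ∈ s.erase i, f j) • v i‖ ≤ s.card * (r * ∏ j ∈ s, b j) := by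
  rw [← nsmul_eq_mul]
  refine (norm_sum_le _ _).trans (Finset.sum_le_card_nsmul s _ _ fun i hi => ?_)
  rw [norm_smul, Real.norm_eq_abs]
  exact prod_erase_mul_le hf hi hr (hv i hi)

end LeibnizBounds

section Product

variable {d : ℕ}

/-- The coordinate functional `(x, y) ↦ x_i`. -/
def coordX (i : Fin d) : EuclideanSpace ℝ (Fin d) × EuclideanSpace ℝ (Fin d) →L[ℝ] ℝ :=
  (EuclideanSpace.proj i : EuclideanSpace ℝ (Fin d) →L[ℝ] ℝ).comp (ContinuousLinearMap.fst ℝ _ _)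

/-- The coordinate functional `(x, y) ↦ y_i`. -/
def coordY (i : Fin d) : EuclideanSpace ℝ (Fin d) × EuclideanSpace ℝ (Fin d) →L[ℝ] ℝ :=
  (EuclideanSpace.proj i : EuclideanSpace ℝ (Fin d) →L[ℝ] ℝ).comp (ContinuousLinearMap.snd ℝ _ _)

lemma norm_coordX_le (i : Fin d) : ‖coordX i‖ ≤ 1 :=
  ContinuousLinearMap.opNorm_le_bound _ zero_le_one fun p => by
    rw [one_mul]
    exact (PiLp.norm_apply_le p.1 i).trans (norm_fst_le p)

lemma norm_coordY_le (i : Fin d) : ‖coordY i‖ ≤ 1 :=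
  ContinuousLinearMap.opNorm_le_bound _ zero_le_one fun p => by
    rw [one_mul]
    exact (PiLp.norm_apply_le p.2 i).trans (norm_snd_le p)

lemma norm_smul_coord_add_le (i : Fin d) {a b c : ℝ} (ha : |a| ≤ c) (hb : |b| ≤ c) :
    ‖a • coordX i + b • coordY i‖ ≤ 2 * c := by
  refine (norm_add_le _ _).trans ?_
  rw [norm_smul, norm_smul, Real.norm_eq_abs, Real.norm_eq_abs]
  have h1 := mul_le_mul ha (norm_coordX_le i) (norm_nonneg _) ((abs_nonneg _).trans ha)
  have h2 := mul_le_mul hb (norm_coordY_le i) (norm_nonneg _) ((abs_nonneg _).trans hb)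
  linarith

lemma hasFDerivAt_comp_coord {f : ℝ × ℝ → ℝ} {a b : ℝ}
    (p : EuclideanSpace ℝ (Fin d) × EuclideanSpace ℝ (Fin d)) (i : Fin d)
    (hf : HasFDerivAt f (a • ContinuousLinearMap.fst ℝ ℝ ℝ + b • ContinuousLinearMap.snd ℝ ℝ ℝ)
      (p.1 i, p.2 i)) :
    HasFDerivAt (fun p : EuclideanSpace ℝ (Fin d) × EuclideanSpace ℝ (Fin d) => f (p.1 i, p.2 i))
      (a • coordX i + b • coordY i) p := by
  have h : HasFDerivAt
      (fun p : EuclideanSpace ℝ (Fin d) × EuclideanSpace ℝ (Fin d) => (p.1 i, p.2 i))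
      ((coordX i).prod (coordY i)) p := ((coordX i).prod (coordY i)).hasFDerivAt
  refine (HasFDerivAt.comp p hf h).congr_fderiv ?_
  ext <;> simp

variable (α : Fin d → ℝ) (θ θ₁ θ₂ : Fin d → ℝ → ℝ)

/-- The product of the one-dimensional kernels. -/
def prodKernel (t : ℝ) (p : EuclideanSpace ℝ (Fin d) × EuclideanSpace ℝ (Fin d)) : ℝ :=
  ∏ i, factor (α i) (θ i) t (p.1 i) (p.2 i)

/-- The time derivative of `prodKernel`. -/
def prodKernelT (t : ℝ) (p : EuclideanSpace ℝ (Fin d) × EuclideanSpace ℝ (Fin d)) : ℝ :=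
  ∑ i, (∏ j ∈ Finset.univ.erase i, factor (α j) (θ j) t (p.1 j) (p.2 j)) •
    factorT (α i) (θ i) (θ₁ i) t (p.1 i) (p.2 i)

/-- The differential in `(x, y)` of the `i`-th factor. -/
def factorD (i : Fin d) (t : ℝ) (p : EuclideanSpace ℝ (Fin d) × EuclideanSpace ℝ (Fin d)) :
    EuclideanSpace ℝ (Fin d) × EuclideanSpace ℝ (Fin d) →L[ℝ] ℝ :=
  factorX (α i) (θ i) (θ₁ i) t (p.1 i) (p.2 i) • coordX i +
    factorX (α i) (θ i) (θ₁ i) t (p.2 i) (p.1 i) • coordY i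

/-- The differential in `(x, y)` of the time derivative of the `i`-th factor. -/
def factorTD (i : Fin d) (t : ℝ) (p : EuclideanSpace ℝ (Fin d) × EuclideanSpace ℝ (Fin d)) :
    EuclideanSpace ℝ (Fin d) × EuclideanSpace ℝ (Fin d) →L[ℝ] ℝ :=
  factorTX (α i) (θ i) (θ₁ i) (θ₂ i) t (p.1 i) (p.2 i) • coordX i +
    factorTX (α i) (θ i) (θ₁ i) (θ₂ i) t (p.2 i) (p.1 i) • coordY i

/-- The differential in `(x, y)` of `prodKernel`. -/
def prodKernelD (t : ℝ) (p : EuclideanSpace ℝ (Fin d) × EuclideanSpace ℝ (Fin d)) :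
    EuclideanSpace ℝ (Fin d) × EuclideanSpace ℝ (Fin d) →L[ℝ] ℝ :=
  ∑ i, (∏ j ∈ Finset.univ.erase i, factor (α j) (θ j) t (p.1 j) (p.2 j)) • factorD α θ θ₁ i t p

/-- The differential in `(x, y)` of the time derivative of `prodKernel`. -/
def prodKernelTD (t : ℝ) (p : EuclideanSpace ℝ (Fin d) × EuclideanSpace ℝ (Fin d)) :
    EuclideanSpace ℝ (Fin d) × EuclideanSpace ℝ (Fin d) →L[ℝ] ℝ :=
  ∑ i, ((∏ j ∈ Finset.univ.erase i, factor (α j) (θ j) t (p.1 j) (p.2 j)) •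
      factorTD α θ θ₁ θ₂ i t p +
    factorT (α i) (θ i) (θ₁ i) t (p.1 i) (p.2 i) • ∑ j ∈ Finset.univ.erase i,
      (∏ k ∈ (Finset.univ.erase i).erase j, factor (α k) (θ k) t (p.1 k) (p.2 k)) •
        factorD α θ θ₁ j t p)

variable {α θ θ₁ θ₂}

lemma hasDerivAt_prodKernel (h : ∀ i, IsSymbol (α i + 1 / 2) (θ i) (θ₁ i) (θ₂ i)) {t : ℝ}
    (ht : 0 < t) (p : EuclideanSpace ℝ (Fin d) × EuclideanSpace ℝ (Fin d)) :
    HasDerivAt (fun t => prodKernel α θ t p) (prodKernelT α θ θ₁ t p) t :=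
  HasDerivAt.fun_finsetProd fun i _ => hasDerivAt_factor_time (h i).hasDerivAt ht _ _

lemma hasFDerivAt_prodKernel (h : ∀ i, IsSymbol (α i + 1 / 2) (θ i) (θ₁ i) (θ₂ i)) (t : ℝ)
    (p : EuclideanSpace ℝ (Fin d) × EuclideanSpace ℝ (Fin d)) :
    HasFDerivAt (prodKernel α θ t) (prodKernelD α θ θ₁ t p) p :=
  HasFDerivAt.finsetProd fun i _ => hasFDerivAt_comp_coord p i
    (hasFDerivAt_factor (h i).hasDerivAt t (p.1 i) (p.2 i))

lemma hasFDerivAt_prodKernelT (h : ∀ i, IsSymbol (α i + 1 / 2) (θ i) (θ₁ i) (θ₂ i)) (t : ℝ)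
    (p : EuclideanSpace ℝ (Fin d) × EuclideanSpace ℝ (Fin d)) :
    HasFDerivAt (prodKernelT α θ θ₁ t) (prodKernelTD α θ θ₁ θ₂ t p) p :=
  HasFDerivAt.fun_sum fun i _ => (HasFDerivAt.finsetProd fun j _ => hasFDerivAt_comp_coord p j
    (hasFDerivAt_factor (h j).hasDerivAt t (p.1 j) (p.2 j))).fun_mul
      (hasFDerivAt_comp_coord p i
        (hasFDerivAt_factorT (h i).hasDerivAt (h i).hasDerivAt' t (p.1 i) (p.2 i)))

lemma continuousOn_prodKernel_family (h : ∀ i, IsSymbol (α i + 1 / 2) (θ i) (θ₁ i) (θ₂ i))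
    (p : EuclideanSpace ℝ (Fin d) × EuclideanSpace ℝ (Fin d)) :
    ContinuousOn (fun t => prodKernel α θ t p) (Ioi 0) ∧
    ContinuousOn (fun t => prodKernelT α θ θ₁ t p) (Ioi 0) ∧
    ContinuousOn (fun t => prodKernelD α θ θ₁ t p) (Ioi 0) ∧
    ContinuousOn (fun t => prodKernelTD α θ θ₁ θ₂ t p) (Ioi 0) := by
  have c (i : Fin d) := continuousOn_factor_family (h i) (p.1 i) (p.2 i)
  have c' (i : Fin d) := continuousOn_factor_family (h i) (p.2 i) (p.1 i)
  have hD (i : Fin d) : ContinuousOn (fun t => factorD α θ θ₁ i t p) (Ioi 0) :=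
    ((c i).2.2.1.smul continuousOn_const).add ((c' i).2.2.1.smul continuousOn_const)
  have hTD (i : Fin d) : ContinuousOn (fun t => factorTD α θ θ₁ θ₂ i t p) (Ioi 0) :=
    ((c i).2.2.2.smul continuousOn_const).add ((c' i).2.2.2.smul continuousOn_const)
  have hP (s : Finset (Fin d)) : ContinuousOn
      (fun t => ∏ j ∈ s, factor (α j) (θ j) t (p.1 j) (p.2 j)) (Ioi 0) :=
    continuousOn_finsetProd _ fun j _ => (c j).1
  refine ⟨hP _, ?_, ?_, ?_⟩
  · exact continuousOn_finsetSum _ fun i _ => (hP _).smul (c i).2.1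
  · exact continuousOn_finsetSum _ fun i _ => (hP _).smul (hD i)
  · exact continuousOn_finsetSum _ fun i _ => ((hP _).smul (hTD i)).add
      ((c i).2.1.smul (continuousOn_finsetSum _ fun j _ => (hP _).smul (hD j)))

lemma exists_prodKernel_family_le (hα : ∀ i, -(1 / 2) ≤ α i)
    (h : ∀ i, IsSymbol (α i + 1 / 2) (θ i) (θ₁ i) (θ₂ i)) :
    ∃ C, 0 < C ∧ ∀ t, 0 < t → ∀ p : EuclideanSpace ℝ (Fin d) × EuclideanSpace ℝ (Fin d),
      p.1 ∈ orthant d → p.2 ∈ orthant d →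
      |prodKernel α θ t p| ≤ C * ∏ i, majorant (α i + 1 / 2) t (p.1 i) (p.2 i) ∧
      |prodKernelT α θ θ₁ t p| ≤
        C * (invSqrtTanh t ^ 2 * ∏ i, majorant (α i + 1 / 2) t (p.1 i) (p.2 i)) ∧
      ‖prodKernelD α θ θ₁ t p‖ ≤
        C * (invSqrtTanh t * ∏ i, majorant (α i + 1 / 2) t (p.1 i) (p.2 i)) ∧
      ‖prodKernelTD α θ θ₁ θ₂ t p‖ ≤
        C * (invSqrtTanh t ^ 3 * ∏ i, majorant (α i + 1 / 2) t (p.1 i) (p.2 i)) := by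
  choose C hC using fun i => exists_factor_family_le (hα i) (h i)
  set N : ℝ := (Fintype.card (Fin d) : ℝ) with hN
  have hN0 : 0 ≤ N := Nat.cast_nonneg _
  -- the Leibniz rule gives the constants `1`, `N`, `2N` and `N(2+2N)` in the four bounds
  refine ⟨(1 + N) * (2 + 2 * N) * ∏ i, (1 + |C i|), ?_, fun t ht p hx hy => ?_⟩
  · have : 0 < ∏ i, (1 + |C i|) := Finset.prod_pos fun i _ => by positivity
    positivity
  have hρ := invSqrtTanh_pos ht
  have hmaj (i : Fin d) : 0 ≤ majorant (α i + 1 / 2) t (p.1 i) (p.2 i) := by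
    have := (tanh_mem ht).1
    rw [majorant]
    positivity
  set b : Fin d → ℝ := fun i => (1 + |C i|) * majorant (α i + 1 / 2) t (p.1 i) (p.2 i) with hb
  have hb0 (i : Fin d) : 0 ≤ b i := mul_nonneg (by positivity) (hmaj i)
  have conv (i : Fin d) {c r : ℝ} (hr : 0 ≤ r)
      (hc : c ≤ C i * (r * majorant (α i + 1 / 2) t (p.1 i) (p.2 i))) : c ≤ r * b i := by
    have h1 : C i ≤ 1 + |C i| := by linarith [le_abs_self (C i)]
    have h2 := hmaj i
    calc c ≤ (1 + |C i|) * (r * majorant (α i + 1 / 2) t (p.1 i) (p.2 i)) :=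
          hc.trans (by gcongr)
      _ = r * b i := by rw [hb]; ring
  have f0 (i : Fin d) : |factor (α i) (θ i) t (p.1 i) (p.2 i)| ≤ b i := by
    simpa using conv i zero_le_one (by simpa using (hC i t ht _ _ (hx i) (hy i)).1)
  have fT (i : Fin d) : |factorT (α i) (θ i) (θ₁ i) t (p.1 i) (p.2 i)| ≤
      invSqrtTanh t ^ 2 * b i := conv i (by positivity) (hC i t ht _ _ (hx i) (hy i)).2.1
  have fD (i : Fin d) : ‖factorD α θ θ₁ i t p‖ ≤ 2 * invSqrtTanh t * b i := by
    rw [mul_assoc]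
    exact norm_smul_coord_add_le i (conv i hρ.le (hC i t ht _ _ (hx i) (hy i)).2.2.1)
      (conv i hρ.le (hC i t ht _ _ (hx i) (hy i)).2.2.2.1)
  have fTD (i : Fin d) : ‖factorTD α θ θ₁ θ₂ i t p‖ ≤ 2 * invSqrtTanh t ^ 3 * b i := by
    rw [mul_assoc]
    exact norm_smul_coord_add_le i
      (conv i (by positivity) (hC i t ht _ _ (hx i) (hy i)).2.2.2.2.1)
      (conv i (by positivity) (hC i t ht _ _ (hx i) (hy i)).2.2.2.2.2)
  have hprod : ∏ i, b i =
      (∏ i, (1 + |C i|)) * ∏ i, majorant (α i + 1 / 2) t (p.1 i) (p.2 i) :=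
    Finset.prod_mul_distrib
  have hB : 0 ≤ ∏ i, b i := Finset.prod_nonneg fun i _ => hb0 i
  have fin {c r : ℝ} (hr : 0 ≤ r) {K : ℝ} (hK : K ≤ (1 + N) * (2 + 2 * N))
      (hc : c ≤ K * (r * ∏ i, b i)) :
      c ≤ (1 + N) * (2 + 2 * N) * (∏ i, (1 + |C i|)) *
        (r * ∏ i, majorant (α i + 1 / 2) t (p.1 i) (p.2 i)) := by
    calc c ≤ (1 + N) * (2 + 2 * N) * (r * ∏ i, b i) := hc.trans (by gcongr)
      _ = _ := by rw [hprod]; ring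
  refine ⟨?_, ?_, ?_, ?_⟩
  · have := fin (c := |prodKernel α θ t p|) (r := 1) (K := 1) zero_le_one (by nlinarith) ?_
    · simpa using this
    · rw [one_mul, one_mul, prodKernel, Finset.abs_prod]
      exact Finset.prod_le_prod (fun _ _ => abs_nonneg _) fun i _ => f0 i
  · refine fin (K := N) (by positivity) (by nlinarith) ?_
    refine (norm_sum_prod_erase_smul_le (r := invSqrtTanh t ^ 2)
      (v := fun i => factorT (α i) (θ i) (θ₁ i) t (p.1 i) (p.2 i)) (by positivity)
      (fun i _ => f0 i) fun i _ => fT i).trans_eq ?_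
    rw [Finset.card_univ]
  · refine fin (K := 2 * N) hρ.le (by nlinarith) ?_
    refine (norm_sum_prod_erase_smul_le (by positivity) (fun i _ => f0 i) fun i _ =>
      fD i).trans_eq ?_
    rw [Finset.card_univ]
    ring
  · refine fin (K := N * (2 + 2 * N)) (by positivity) (by nlinarith) ?_
    have hi (i : Fin d) : ‖(∏ j ∈ Finset.univ.erase i, factor (α j) (θ j) t (p.1 j) (p.2 j)) •
        factorTD α θ θ₁ θ₂ i t p + factorT (α i) (θ i) (θ₁ i) t (p.1 i) (p.2 i) •
        ∑ j ∈ Finset.univ.erase i, (∏ k ∈ (Finset.univ.erase i).erase j,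
          factor (α k) (θ k) t (p.1 k) (p.2 k)) • factorD α θ θ₁ j t p‖ ≤
        (2 + 2 * N) * (invSqrtTanh t ^ 3 * ∏ i, b i) := by
      refine (norm_add_le _ _).trans ?_
      rw [norm_smul, norm_smul, Real.norm_eq_abs, Real.norm_eq_abs, add_mul]
      refine add_le_add ?_ ?_
      · rw [← mul_assoc]
        exact prod_erase_mul_le (fun i _ => f0 i) (Finset.mem_univ i) (by positivity) (fTD i)
      · have h1 := norm_sum_prod_erase_smul_le (s := Finset.univ.erase i)
          (r := 2 * invSqrtTanh t) (by positivity) (fun j _ => f0 j) fun j _ => fD j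
        have h2 : (((Finset.univ.erase i).card : ℕ) : ℝ) ≤ N :=
          Nat.cast_le.2 (Finset.card_le_univ _)
        have h3 : 0 ≤ ∏ j ∈ Finset.univ.erase i, b j := Finset.prod_nonneg fun j _ => hb0 j
        calc _ ≤ (invSqrtTanh t ^ 2 * b i) *
              (N * (2 * invSqrtTanh t * ∏ j ∈ Finset.univ.erase i, b j)) := by
              refine mul_le_mul (fT i) (h1.trans (by gcongr)) (norm_nonneg _)
                (mul_nonneg (by positivity) (hb0 i))
          _ = 2 * N * (invSqrtTanh t ^ 3 * ((∏ j ∈ Finset.univ.erase i, b j) * b i)) := by ring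
          _ = _ := by rw [Finset.prod_erase_mul _ _ (Finset.mem_univ i)]
    refine ((norm_sum_le _ _).trans
      (Finset.sum_le_card_nsmul Finset.univ _ _ fun i _ => hi i)).trans_eq ?_
    rw [nsmul_eq_mul, Finset.card_univ]
    ring

end Product

/-! ### The kernel as a product -/

lemma factor_eq {α : ℝ} {ε : Fin 2} {θ : ℝ → ℝ}
    (hθ : ∀ z, 0 < z → z ^ (ε : ℕ) * (besselI (α + ((ε : ℕ) : ℝ)) z / z ^ (α + ((ε : ℕ) : ℝ))) =
      Real.exp z * θ z) {t x y : ℝ} (ht : 0 < t) (hx : 0 < x) (hy : 0 < y) :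
    factor α θ t x y = csch t / 2 * Real.exp (-(coth t / 2 * (x ^ 2 + y ^ 2))) *
      ((x * y) ^ (ε : ℕ) * (besselI (α + ((ε : ℕ) : ℝ)) (x * y / Real.sinh (2 * t)) /
        (x * y) ^ (α + ((ε : ℕ) : ℝ)))) := by
  have hκ := csch_pos ht
  have hz : 0 < csch t * (x * y) := by positivity
  have h := hθ _ hz
  rw [show x * y / Real.sinh (2 * t) = csch t * (x * y) by rw [csch]; ring]
  have e1 : Real.exp (-mehlerExp t x y) = Real.exp (csch t * (x * y)) *
      Real.exp (-(coth t / 2 * (x ^ 2 + y ^ 2))) := by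
    rw [mehlerExp, ← Real.exp_add]
    ring_nf
  have e2 : csch t ^ (α + ((ε : ℕ) : ℝ)) = csch t ^ α * csch t ^ (ε : ℕ) := by
    rw [Real.rpow_add hκ, Real.rpow_natCast]
  have e3 : csch t ^ (1 + α) = csch t * csch t ^ α := by
    rw [Real.rpow_add hκ, Real.rpow_one]
  rw [Real.mul_rpow hκ.le (by positivity), mul_pow, e2] at h
  have p1 : csch t ^ α ≠ 0 := by positivity
  have p2 : csch t ^ (ε : ℕ) ≠ 0 := by positivity
  have p3 : (x * y) ^ (α + ((ε : ℕ) : ℝ)) ≠ 0 := by positivity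
  have h' : csch t ^ α * (Real.exp (csch t * (x * y)) * θ (csch t * (x * y))) = (x * y) ^ (ε : ℕ) *
      (besselI (α + ((ε : ℕ) : ℝ)) (csch t * (x * y)) / (x * y) ^ (α + ((ε : ℕ) : ℝ))) := by
    rw [← h]
    field_simp
  rw [factor, mehlerFactor, e1, e3, ← h']
  ring

lemma G_eq_prodKernel {d : ℕ} {α : Fin d → ℝ} {ε : Fin d → Fin 2} {θ : Fin d → ℝ → ℝ}
    (hθ : ∀ i z, 0 < z → z ^ (ε i : ℕ) *
      (besselI (α i + ((ε i : ℕ) : ℝ)) z / z ^ (α i + ((ε i : ℕ) : ℝ))) = Real.exp z * θ i z)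
    {t : ℝ} (ht : 0 < t) {x y : EuclideanSpace ℝ (Fin d)} (hx : x ∈ orthant d)
    (hy : y ∈ orthant d) : G α ε t x y = prodKernel α θ t (x, y) := by
  have h1 : ((2 * Real.sinh (2 * t)) ^ d)⁻¹ = ∏ _i : Fin d, csch t / 2 := by
    rw [Finset.prod_const, Finset.card_univ, Fintype.card_fin, ← inv_pow, mul_inv, csch]
    ring
  have h2 : Real.exp (-(1 / 2) * (Real.cosh (2 * t) / Real.sinh (2 * t)) * (‖x‖ ^ 2 + ‖y‖ ^ 2)) =
      ∏ i : Fin d, Real.exp (-(coth t / 2 * (x i ^ 2 + y i ^ 2))) := by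
    rw [← Real.exp_sum, EuclideanSpace.norm_sq_eq, EuclideanSpace.norm_sq_eq,
      ← Finset.sum_add_distrib, Finset.mul_sum]
    simp only [Real.norm_eq_abs, sq_abs, coth]
    congr 1
    exact Finset.sum_congr rfl fun i _ => by ring
  rw [G, prodKernel, h1, h2, ← Finset.prod_mul_distrib, ← Finset.prod_mul_distrib]
  exact Finset.prod_congr rfl fun i _ => (factor_eq (hθ i) ht (hx i) (hy i)).symm

/-! ### Comparison with the measure of a ball -/

/-- The quantity `r^d ∏ (r + x_i)^(2α_i+1)`, comparable to the measure of the ball of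
centre `x` and radius `r`. -/
def ballWeight {d : ℕ} (α : Fin d → ℝ) (x : EuclideanSpace ℝ (Fin d)) (r : ℝ) : ℝ :=
  r ^ d * ∏ i, (r + x i) ^ (2 * α i + 1)

lemma ballWeight_pos {d : ℕ} (α : Fin d → ℝ) {x : EuclideanSpace ℝ (Fin d)} (hx : x ∈ orthant d)
    {r : ℝ} (hr : 0 < r) : 0 < ballWeight α x r :=
  mul_pos (by positivity) (Finset.prod_pos fun i _ => by have := hx i; positivity)

lemma isOpen_orthant (d : ℕ) : IsOpen (orthant d) := by
  simp only [orthant, ofPred_forall]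
  exact isOpen_iInter_of_finite fun i => isOpen_lt continuous_const (by fun_prop)

lemma measurable_weight {d : ℕ} (α : Fin d → ℝ) :
    Measurable fun x : EuclideanSpace ℝ (Fin d) => ∏ j, |x j| ^ (2 * α j + 1) := by
  fun_prop

lemma exists_wPlus_ball_le {d : ℕ} (hd : 1 ≤ d) {α : Fin d → ℝ} (hα : ∀ i, -(1 / 2) ≤ α i) :
    ∃ C, 0 < C ∧ ∀ x ∈ orthant d, ∀ r, 0 < r →
      0 < (wPlus α).real (Metric.ball x r) ∧
        (wPlus α).real (Metric.ball x r) ≤ C * ballWeight α x r := by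
  have : Nonempty (Fin d) := ⟨⟨0, hd⟩⟩
  refine ⟨√Real.pi ^ d / Real.Gamma ((d : ℝ) / 2 + 1), ?_, fun x hx r hr => ?_⟩
  · have := Real.Gamma_pos_of_pos (by positivity : 0 < (d : ℝ) / 2 + 1)
    positivity
  have hK : 0 ≤ √Real.pi ^ d / Real.Gamma ((d : ℝ) / 2 + 1) := by
    have := Real.Gamma_pos_of_pos (by positivity : 0 < (d : ℝ) / 2 + 1)
    positivity
  have hopen := (Metric.isOpen_ball (x := x) (ε := r)).inter (isOpen_orthant d)
  have hw : wPlus α (Metric.ball x r) = ∫⁻ z in Metric.ball x r ∩ orthant d,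
      ENNReal.ofReal (∏ j, |z j| ^ (2 * α j + 1)) := by
    rw [wPlus, Measure.restrict_apply measurableSet_ball, w,
      withDensity_apply _ hopen.measurableSet]
  have hup : wPlus α (Metric.ball x r) ≤
      ENNReal.ofReal (√Real.pi ^ d / Real.Gamma ((d : ℝ) / 2 + 1) * ballWeight α x r) := by
    have hprod : 0 ≤ ∏ i, (r + x i) ^ (2 * α i + 1) := Finset.prod_nonneg fun i _ => by
      have := hx i
      positivity
    calc wPlus α (Metric.ball x r) ≤ ∫⁻ _z in Metric.ball x r ∩ orthant d,
          ENNReal.ofReal (∏ i, (r + x i) ^ (2 * α i + 1)) := by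
          rw [hw]
          refine setLIntegral_mono measurable_const fun z hz => ENNReal.ofReal_le_ofReal ?_
          refine Finset.prod_le_prod (fun i _ => by positivity) fun i _ => ?_
          have hzi : 0 < z i := hz.2 i
          have h1 : ‖z i - x i‖ ≤ ‖z - x‖ := PiLp.norm_apply_le (z - x) i
          have h2 : ‖z - x‖ < r := mem_ball_iff_norm.1 hz.1
          rw [Real.norm_eq_abs] at h1
          have h3 := le_abs_self (z i - x i)
          have h4 := hα i
          refine Real.rpow_le_rpow (abs_nonneg _) ?_ (by linarith)
          rw [abs_of_pos hzi]
          linarith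
      _ ≤ ENNReal.ofReal (∏ i, (r + x i) ^ (2 * α i + 1)) * volume (Metric.ball x r) := by
          rw [setLIntegral_const]
          gcongr
          exact inter_subset_left
      _ = _ := by
          rw [EuclideanSpace.volume_ball, Fintype.card_fin, ← ENNReal.ofReal_pow hr.le,
            ← ENNReal.ofReal_mul (by positivity), ← ENNReal.ofReal_mul hprod, ballWeight]
          congr 1
          ring
  have hbw := (ballWeight_pos α hx hr).le
  have hpos : 0 < wPlus α (Metric.ball x r) := by
    rw [hw, setLIntegral_pos_iff (measurable_weight α).ennreal_ofReal]
    have hsub : Metric.ball x r ∩ orthant d ⊆ Function.support (fun z : EuclideanSpace ℝ (Fin d) =>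
        ENNReal.ofReal (∏ j, |z j| ^ (2 * α j + 1))) := fun z hz => by
      rw [Function.mem_support]
      refine (ENNReal.ofReal_pos.2 (Finset.prod_pos fun i _ => ?_)).ne'
      have : 0 < |z i| := abs_pos.2 (ne_of_gt (hz.2 i))
      positivity
    rw [inter_eq_self_of_subset_right hsub]
    exact hopen.measure_pos volume ⟨x, Metric.mem_ball_self hr, hx⟩
  exact ⟨ENNReal.toReal_pos hpos.ne' (hup.trans_lt ENNReal.ofReal_lt_top).ne,
    ENNReal.toReal_le_of_le_ofReal (by positivity) hup⟩

/-- The product of the one-dimensional majorants against the measure of the ball of centre `x` and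
radius `r = |x-y|`. The right-hand side is a power of the scaling variable `w = r (tanh t)^(-1/2)`
times a Gaussian in `w`. -/
lemma prod_majorant_mul_ballWeight_le {d : ℕ} {α : Fin d → ℝ} (hα : ∀ i, -(1 / 2) ≤ α i) {t : ℝ}
    (ht : 0 < t) {x y : EuclideanSpace ℝ (Fin d)} (hx : x ∈ orthant d) {w : ℝ}
    (hw : w = ‖x - y‖ * invSqrtTanh t) :
    Real.exp (t * lambda0 α) * ((∏ i, majorant (α i + 1 / 2) t (x i) (y i)) *
        ballWeight α x ‖x - y‖) ≤
      2 ^ (∑ i, (α i + 1 / 2)) * (w ^ d * (1 + w ^ 2) ^ (∑ i, (α i + 1 / 2)) *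
        Real.exp (-(1 / 8 * w ^ 2))) := by
  have h0 := (tanh_mem ht).1
  have hρ := invSqrtTanh_pos ht
  have hw2 : w ^ 2 = ‖x - y‖ ^ 2 / Real.tanh t := by
    rw [hw, mul_pow, invSqrtTanh_sq ht, div_eq_mul_inv]
  have e1 : ∏ i, Real.exp (-(2 * t * (α i + 1 / 2 + 1 / 2))) = Real.exp (-(t * lambda0 α)) := by
    rw [← Real.exp_sum, lambda0, Finset.sum_neg_distrib, ← Finset.mul_sum]
    simp only [Finset.sum_add_distrib, Finset.sum_const, Finset.card_univ, Fintype.card_fin,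
      nsmul_eq_mul]
    ring_nf
  have e2 : ∏ i, Real.exp (-((x i - y i) ^ 2 / (8 * Real.tanh t))) =
      Real.exp (-(1 / 8 * w ^ 2)) := by
    rw [← Real.exp_sum, hw2, EuclideanSpace.norm_sq_eq, Finset.sum_neg_distrib, ← Finset.sum_div]
    simp only [Real.norm_eq_abs, sq_abs, PiLp.sub_apply]
    congr 1
    field_simp
  have e3 (i : Fin d) : (Real.tanh t + x i ^ 2) ^ (-(α i + 1 / 2)) *
      (‖x - y‖ + x i) ^ (2 * α i + 1) ≤ 2 ^ (α i + 1 / 2) * (1 + w ^ 2) ^ (α i + 1 / 2) := by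
    have hxi := hx i
    have ha : 0 ≤ α i + 1 / 2 := by linarith [hα i]
    have e : (‖x - y‖ + x i) ^ (2 * α i + 1) = ((‖x - y‖ + x i) ^ 2) ^ (α i + 1 / 2) := by
      rw [← Real.rpow_natCast, ← Real.rpow_mul (by positivity)]
      congr 1
      push_cast
      ring
    rw [e, Real.rpow_neg (by positivity), inv_mul_le_iff₀ (by positivity),
      ← Real.mul_rpow (by positivity) (by positivity),
      ← Real.mul_rpow (by positivity) (by positivity)]
    refine Real.rpow_le_rpow (by positivity) ?_ ha
    have hr2 : ‖x - y‖ ^ 2 = Real.tanh t * w ^ 2 := by rw [hw2]; field_simp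
    nlinarith [sq_nonneg (‖x - y‖ - x i), mul_nonneg (sq_nonneg (x i)) (sq_nonneg w)]
  have e4 : (∏ i, (Real.tanh t + x i ^ 2) ^ (-(α i + 1 / 2))) *
      ∏ i, (‖x - y‖ + x i) ^ (2 * α i + 1) ≤
      2 ^ (∑ i, (α i + 1 / 2)) * (1 + w ^ 2) ^ (∑ i, (α i + 1 / 2)) := by
    rw [← Finset.prod_mul_distrib, Real.rpow_sum_of_pos two_pos,
      Real.rpow_sum_of_pos (by positivity), ← Finset.prod_mul_distrib]
    refine Finset.prod_le_prod (fun i _ => ?_) fun i _ => e3 i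
    have := hx i
    positivity
  have e5 : ∏ i, majorant (α i + 1 / 2) t (x i) (y i) = Real.exp (-(t * lambda0 α)) *
      (invSqrtTanh t ^ d * (∏ i, (Real.tanh t + x i ^ 2) ^ (-(α i + 1 / 2))) *
        Real.exp (-(1 / 8 * w ^ 2))) := by
    simp only [majorant, Finset.prod_mul_distrib, e1, e2, Finset.prod_const, Finset.card_univ,
      Fintype.card_fin]
  have e6 : Real.exp (t * lambda0 α) * Real.exp (-(t * lambda0 α)) = 1 := by
    rw [← Real.exp_add, add_neg_cancel, Real.exp_zero]
  calc _ = (Real.exp (t * lambda0 α) * Real.exp (-(t * lambda0 α))) *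
        (‖x - y‖ * invSqrtTanh t) ^ d * Real.exp (-(1 / 8 * w ^ 2)) *
        ((∏ i, (Real.tanh t + x i ^ 2) ^ (-(α i + 1 / 2))) *
          ∏ i, (‖x - y‖ + x i) ^ (2 * α i + 1)) := by
        rw [e5, ballWeight]
        ring
    _ ≤ (Real.exp (t * lambda0 α) * Real.exp (-(t * lambda0 α))) *
        (‖x - y‖ * invSqrtTanh t) ^ d * Real.exp (-(1 / 8 * w ^ 2)) *
        (2 ^ (∑ i, (α i + 1 / 2)) * (1 + w ^ 2) ^ (∑ i, (α i + 1 / 2))) := by gcongr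
    _ = _ := by
        rw [e6, ← hw]
        ring

/-- Scaling profile: for `d ≥ 1` a positive power of `w` is left, which is what makes the
time integral converge uniformly in `r = |x-y|`. -/
lemma exists_profile_le {d : ℕ} (hd : 1 ≤ d) (A : ℝ) :
    ∃ C, 0 < C ∧ ∀ w, 0 ≤ w →
      w ^ d * (1 + w ^ 2) ^ A * Real.exp (-(1 / 8 * w ^ 2)) ≤
        C * (w * (1 + w ^ 2) ^ (-(3 / 2 : ℝ))) ∧
      w * (w ^ d * (1 + w ^ 2) ^ A * Real.exp (-(1 / 8 * w ^ 2))) ≤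
        C * (w * (1 + w ^ 2) ^ (-(3 / 2 : ℝ))) := by
  obtain ⟨C, hC0, hC⟩ := exists_one_add_rpow_mul_exp_le (d + A + 3 / 2) (c := 1 / 8) (by norm_num)
  refine ⟨C, hC0, fun w hw => ?_⟩
  have hw1 : w ≤ 1 + w ^ 2 := by nlinarith [sq_nonneg (w - 1)]
  have h1 : 1 ≤ 1 + w ^ 2 := by nlinarith [sq_nonneg w]
  obtain ⟨n, rfl⟩ : ∃ n, d = n + 1 := ⟨d - 1, by omega⟩
  have key {m : ℕ} (hm : m ≤ n + 1) :
      w * (w ^ m * (1 + w ^ 2) ^ A * Real.exp (-(1 / 8 * w ^ 2))) ≤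
        C * (w * (1 + w ^ 2) ^ (-(3 / 2 : ℝ))) := by
    have e : (1 + w ^ 2) ^ (n + 1) * (1 + w ^ 2) ^ A =
        (1 + w ^ 2) ^ (((n + 1 : ℕ) : ℝ) + A + 3 / 2) * (1 + w ^ 2) ^ (-(3 / 2 : ℝ)) := by
      rw [← Real.rpow_natCast, ← Real.rpow_add (by positivity), ← Real.rpow_add (by positivity)]
      ring_nf
    calc _ ≤ w * ((1 + w ^ 2) ^ (n + 1) * (1 + w ^ 2) ^ A * Real.exp (-(1 / 8 * w ^ 2))) := by
          gcongr
          exact (pow_le_pow_left₀ hw hw1 m).trans (pow_le_pow_right₀ h1 hm)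
      _ = ((1 + w ^ 2) ^ (((n + 1 : ℕ) : ℝ) + A + 3 / 2) * Real.exp (-(1 / 8 * w ^ 2))) *
          (w * (1 + w ^ 2) ^ (-(3 / 2 : ℝ))) := by rw [e]; ring
      _ ≤ _ := by
          have := hC (w ^ 2) (sq_nonneg w)
          gcongr
  refine ⟨?_, key le_rfl⟩
  refine le_trans (le_of_eq ?_) (key (m := n) (by omega))
  ring

/-- `tanh t ≥ t/(1+t)`. -/
lemma le_tanh_mul (t : ℝ) : t ≤ Real.tanh t * (1 + t) := by
  have hc := Real.cosh_pos t
  have h := Real.add_one_le_exp (2 * t)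
  rw [Real.tanh_eq_sinh_div_cosh, div_mul_eq_mul_div, le_div_iff₀ hc, Real.sinh_eq, Real.cosh_eq]
  have e : Real.exp t = Real.exp (2 * t) * Real.exp (-t) := by rw [← Real.exp_add]; ring_nf
  have := Real.exp_pos (-t)
  rw [e]
  nlinarith

lemma one_le_lambda0 {d : ℕ} (hd : 1 ≤ d) {α : Fin d → ℝ} (hα : ∀ i, -(1 / 2) ≤ α i) :
    1 ≤ lambda0 α := by
  have h : ∑ _i : Fin d, -(1 / 2 : ℝ) ≤ ∑ i, α i := Finset.sum_le_sum fun i _ => hα i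
  have h2 : (1 : ℝ) ≤ d := by exact_mod_cast hd
  rw [Finset.sum_const, Finset.card_univ, Fintype.card_fin, nsmul_eq_mul] at h
  rw [lambda0]
  linarith

/-- The majorant of the kernel and of its derivatives, with `r = |x-y|`. The two bounds without
time derivative are uniform in `t` after multiplication by `e^{λ₀ t}`; the two bounds with one time
derivative are integrable in `t`, with integral bounded by a constant, respectively by `1/r`. -/
lemma exists_prod_majorant_le {d : ℕ} (hd : 1 ≤ d) {α : Fin d → ℝ} (hα : ∀ i, -(1 / 2) ≤ α i) :
    ∃ C, 0 < C ∧ ∀ t, 0 < t → ∀ x ∈ orthant d, ∀ y ∈ orthant d, x ≠ y →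
      Real.exp (t * lambda0 α) * (∏ i, majorant (α i + 1 / 2) t (x i) (y i)) ≤
        C / ballWeight α x ‖x - y‖ ∧
      Real.exp (t * lambda0 α) *
          (invSqrtTanh t * ∏ i, majorant (α i + 1 / 2) t (x i) (y i)) ≤
        C / (‖x - y‖ * ballWeight α x ‖x - y‖) ∧
      invSqrtTanh t ^ 2 * (∏ i, majorant (α i + 1 / 2) t (x i) (y i)) ≤
        C / ballWeight α x ‖x - y‖ * (‖x - y‖ * (t + ‖x - y‖ ^ 2) ^ (-(3 / 2 : ℝ))) ∧
      invSqrtTanh t ^ 3 * (∏ i, majorant (α i + 1 / 2) t (x i) (y i)) ≤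
        C / ballWeight α x ‖x - y‖ * (t + ‖x - y‖ ^ 2) ^ (-(3 / 2 : ℝ)) := by
  obtain ⟨C, hC0, hC⟩ := exists_profile_le hd (∑ i, (α i + 1 / 2))
  obtain ⟨D, hD0, hD⟩ := exists_one_add_rpow_mul_exp_le (3 / 2) one_pos
  set K : ℝ := 2 ^ (∑ i, (α i + 1 / 2)) with hK
  have hK0 : 0 < K := by positivity
  refine ⟨K * C * (1 + D), by positivity, fun t ht x hx y hy hxy => ?_⟩
  have hr : 0 < ‖x - y‖ := norm_sub_pos_iff.2 hxy
  have hρ := invSqrtTanh_pos ht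
  have h0 := (tanh_mem ht).1
  have hbw := ballWeight_pos α hx hr
  have hP := prod_majorant_mul_ballWeight_le hα ht (y := y) hx rfl
  have hP0 : 0 ≤ ∏ i, majorant (α i + 1 / 2) t (x i) (y i) := Finset.prod_nonneg fun i _ => by
    rw [majorant]
    positivity
  set r := ‖x - y‖ with hrdef
  set ρ := invSqrtTanh t with hρdef
  set P := ∏ i, majorant (α i + 1 / 2) t (x i) (y i)
  set V := ballWeight α x r
  obtain ⟨p1, p2⟩ := hC (r * ρ) (by positivity)
  set F := (r * ρ) ^ d * (1 + (r * ρ) ^ 2) ^ (∑ i, (α i + 1 / 2)) *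
    Real.exp (-(1 / 8 * (r * ρ) ^ 2))
  set S := r * ρ * (1 + (r * ρ) ^ 2) ^ (-(3 / 2 : ℝ)) with hS
  have hS1 : S ≤ 1 := by
    have h1 : r * ρ ≤ (1 + (r * ρ) ^ 2) ^ (3 / 2 : ℝ) := by
      calc r * ρ ≤ (1 + (r * ρ) ^ 2) ^ (1 : ℝ) := by
            rw [Real.rpow_one]
            nlinarith [sq_nonneg (r * ρ - 1)]
        _ ≤ _ := Real.rpow_le_rpow_of_exponent_le (by nlinarith [sq_nonneg (r * ρ)]) (by norm_num)
    rw [hS, Real.rpow_neg (by positivity), ← div_eq_mul_inv]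
    exact div_le_one_of_le₀ h1 (by positivity)
  have hS0 : 0 ≤ S := by positivity
  have hKC : K * C ≤ K * C * (1 + D) := le_mul_of_one_le_right (by positivity) (by linarith)
  -- the bounds with the weight `e^{λ₀ t}`, in terms of the profile `S`
  have q1 : Real.exp (t * lambda0 α) * (P * V) ≤ K * C * S := by
    calc _ ≤ K * F := hP
      _ ≤ K * (C * S) := by gcongr
      _ = _ := by ring
  have q2 : r * (ρ * (Real.exp (t * lambda0 α) * (P * V))) ≤ K * C * S := by
    calc _ = r * ρ * (Real.exp (t * lambda0 α) * (P * V)) := by ring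
      _ ≤ r * ρ * (K * F) := by gcongr
      _ = K * (r * ρ * F) := by ring
      _ ≤ K * (C * S) := by gcongr
      _ = _ := by ring
  have hKCS : K * C * S ≤ K * C * (1 + D) :=
    (mul_le_of_le_one_right (by positivity) hS1).trans hKC
  -- conversion of the weight `e^{-λ₀ t}` into the decay in `t`
  have hexp : Real.exp t ≤ Real.exp (t * lambda0 α) := by
    gcongr
    exact le_mul_of_one_le_right ht.le (one_le_lambda0 hd hα)
  have hdecay : ρ ^ 2 * S ≤ Real.exp t * (D * (r * (t + r ^ 2) ^ (-(3 / 2 : ℝ)))) := by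
    have hτ : t + r ^ 2 ≤ (1 + t) * (Real.tanh t + r ^ 2) := by
      have := le_tanh_mul t
      nlinarith [mul_nonneg ht.le (sq_nonneg r)]
    have e1 : ρ ^ 2 * S = r * (Real.tanh t + r ^ 2) ^ (-(3 / 2 : ℝ)) := by
      have e : 1 + (r * ρ) ^ 2 = (Real.tanh t + r ^ 2) * ρ ^ 2 := by
        rw [mul_pow, hρdef, invSqrtTanh_sq ht]
        field_simp
      have e' : (ρ ^ 2) ^ (-(3 / 2 : ℝ)) = (ρ ^ 3)⁻¹ := by
        rw [← Real.rpow_natCast, ← Real.rpow_natCast, ← Real.rpow_mul hρ.le, ← Real.rpow_neg hρ.le]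
        norm_num
      rw [hS, e, Real.mul_rpow (by positivity) (by positivity), e']
      field_simp
    have e2 : (Real.tanh t + r ^ 2) ^ (-(3 / 2 : ℝ)) ≤
        (1 + t) ^ (3 / 2 : ℝ) * (t + r ^ 2) ^ (-(3 / 2 : ℝ)) := by
      rw [Real.rpow_neg (by positivity), Real.rpow_neg (by positivity), ← div_eq_mul_inv,
        le_div_iff₀ (by positivity), inv_mul_le_iff₀ (by positivity), mul_comm (_ ^ _),
        ← Real.mul_rpow (by positivity) (by positivity)]
      gcongr
    have e3 : (1 + t) ^ (3 / 2 : ℝ) ≤ Real.exp t * D := by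
      have := hD t ht.le
      rw [one_mul, Real.exp_neg, ← div_eq_mul_inv, div_le_iff₀ (Real.exp_pos t)] at this
      linarith
    rw [e1]
    calc _ ≤ r * ((1 + t) ^ (3 / 2 : ℝ) * (t + r ^ 2) ^ (-(3 / 2 : ℝ))) := by gcongr
      _ ≤ r * ((Real.exp t * D) * (t + r ^ 2) ^ (-(3 / 2 : ℝ))) := by gcongr
      _ = _ := by ring
  have hDD : K * C * D ≤ K * C * (1 + D) := by gcongr; linarith
  have htail : 0 ≤ (t + r ^ 2) ^ (-(3 / 2 : ℝ)) := by positivity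
  refine ⟨?_, ?_, ?_, ?_⟩
  · rw [le_div_iff₀ hbw, mul_assoc]
    exact q1.trans hKCS
  · rw [le_div_iff₀ (by positivity)]
    refine le_trans (le_of_eq ?_) (q2.trans hKCS)
    ring
  · have h1 : Real.exp t * (ρ ^ 2 * (P * V)) ≤
        Real.exp t * (K * C * (1 + D) * (r * (t + r ^ 2) ^ (-(3 / 2 : ℝ)))) := by
      calc _ ≤ Real.exp (t * lambda0 α) * (ρ ^ 2 * (P * V)) := by gcongr
        _ = ρ ^ 2 * (Real.exp (t * lambda0 α) * (P * V)) := by ring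
        _ ≤ ρ ^ 2 * (K * C * S) := by gcongr
        _ = K * C * (ρ ^ 2 * S) := by ring
        _ ≤ K * C * (Real.exp t * (D * (r * (t + r ^ 2) ^ (-(3 / 2 : ℝ))))) := by gcongr
        _ = Real.exp t * (K * C * D * (r * (t + r ^ 2) ^ (-(3 / 2 : ℝ)))) := by ring
        _ ≤ _ := by gcongr
    have h2 := le_of_mul_le_mul_left h1 (Real.exp_pos t)
    rw [div_mul_eq_mul_div, le_div_iff₀ hbw]
    linarith
  · have h1 : Real.exp t * (r * (ρ ^ 3 * (P * V))) ≤
        Real.exp t * (r * (K * C * (1 + D) * (t + r ^ 2) ^ (-(3 / 2 : ℝ)))) := by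
      calc _ ≤ Real.exp (t * lambda0 α) * (r * (ρ ^ 3 * (P * V))) := by gcongr
        _ = ρ ^ 2 * (r * (ρ * (Real.exp (t * lambda0 α) * (P * V)))) := by ring
        _ ≤ ρ ^ 2 * (K * C * S) := by gcongr
        _ = K * C * (ρ ^ 2 * S) := by ring
        _ ≤ K * C * (Real.exp t * (D * (r * (t + r ^ 2) ^ (-(3 / 2 : ℝ))))) := by gcongr
        _ = Real.exp t * (r * (K * C * D * (t + r ^ 2) ^ (-(3 / 2 : ℝ)))) := by ring
        _ ≤ _ := by gcongr
    have h2 := le_of_mul_le_mul_left (le_of_mul_le_mul_left h1 (Real.exp_pos t)) hr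
    rw [div_mul_eq_mul_div, le_div_iff₀ hbw]
    linarith

/-! ### Integration in time -/

lemma integrableOn_add_sq_rpow {c : ℝ} (hc : 0 < c) :
    IntegrableOn (fun t : ℝ => (t + c ^ 2) ^ (-(3 / 2 : ℝ))) (Ioi 0) :=
  integrableOn_add_rpow_Ioi_of_lt (by norm_num) (by nlinarith)

lemma integral_add_sq_rpow {c : ℝ} (hc : 0 < c) :
    ∫ t in Ioi (0 : ℝ), (t + c ^ 2) ^ (-(3 / 2 : ℝ)) = 2 / c := by
  have hlim : Filter.Tendsto (fun t : ℝ => -2 * (t + c ^ 2) ^ (-(1 / 2 : ℝ))) Filter.atTop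
      (nhds (-2 * 0)) :=
    ((tendsto_rpow_neg_atTop (by norm_num)).comp
      (Filter.tendsto_atTop_add_const_right _ _ Filter.tendsto_id)).const_mul _
  have h := integral_Ioi_of_hasDerivAt_of_tendsto' (a := 0)
    (f := fun t : ℝ => -2 * (t + c ^ 2) ^ (-(1 / 2 : ℝ)))
    (f' := fun t : ℝ => (t + c ^ 2) ^ (-(3 / 2 : ℝ)))
    (fun t ht => ?_) (integrableOn_add_sq_rpow hc) hlim
  · have e : (c ^ 2) ^ (-(1 / 2 : ℝ)) = c⁻¹ := by
      rw [← Real.rpow_natCast, ← Real.rpow_mul hc.le, ← Real.rpow_neg_one]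
      norm_num
    rw [h, zero_add, e]
    ring
  · have hpos : t + c ^ 2 ≠ 0 := by
      have : (0 : ℝ) ≤ t := ht
      positivity
    refine ((((hasDerivAt_id' t).add_const (c ^ 2)).rpow_const (p := -(1 / 2 : ℝ))
      (Or.inl hpos)).const_mul (-2)).congr_deriv ?_
    norm_num
    ring

lemma gradNorm_le {d : ℕ} {F : EuclideanSpace ℝ (Fin d) → EuclideanSpace ℝ (Fin d) → ℂ}
    {x y : EuclideanSpace ℝ (Fin d)}
    {L : EuclideanSpace ℝ (Fin d) × EuclideanSpace ℝ (Fin d) →L[ℝ] ℂ}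
    (h : HasFDerivAt (Function.uncurry F) L (x, y)) {c : ℝ} (hc : ‖L‖ ≤ c) :
    gradNorm F x y ≤ √(2 * d) * c := by
  have hc0 : 0 ≤ c := (norm_nonneg _).trans hc
  have e1 (j : Fin d) : ‖L (EuclideanSpace.single j (1 : ℝ), 0)‖ ^ 2 ≤ c ^ 2 := by
    have := L.le_of_opNorm_le hc (EuclideanSpace.single j (1 : ℝ), 0)
    rw [Prod.norm_mk, PiLp.norm_single, norm_zero, norm_one,
      max_eq_left zero_le_one, mul_one] at this
    gcongr
  have e2 (j : Fin d) : ‖L (0, EuclideanSpace.single j (1 : ℝ))‖ ^ 2 ≤ c ^ 2 := by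
    have := L.le_of_opNorm_le hc (0, EuclideanSpace.single j (1 : ℝ))
    rw [Prod.norm_mk, PiLp.norm_single, norm_zero, norm_one,
      max_eq_right zero_le_one, mul_one] at this
    gcongr
  rw [gradNorm, h.fderiv]
  refine Real.sqrt_le_iff.2 ⟨by positivity, ?_⟩
  rw [mul_pow, Real.sq_sqrt (by positivity)]
  have h1 := Finset.sum_le_card_nsmul Finset.univ _ _ fun j _ => e1 j
  have h2 := Finset.sum_le_card_nsmul Finset.univ _ _ fun j _ => e2 j
  rw [Finset.card_univ, Fintype.card_fin, nsmul_eq_mul] at h1 h2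
  linarith

lemma le_ballWeight {d : ℕ} {α : Fin d → ℝ} (hα : ∀ i, -(1 / 2) ≤ α i)
    {x : EuclideanSpace ℝ (Fin d)} (hx : x ∈ orthant d) {c r : ℝ} (hc : 0 < c) (hcr : c ≤ r) :
    c ^ d * ∏ i, c ^ (2 * α i + 1) ≤ ballWeight α x r := by
  have h : ∏ i, c ^ (2 * α i + 1) ≤ ∏ i, (r + x i) ^ (2 * α i + 1) := by
    refine Finset.prod_le_prod (fun i _ => by positivity) fun i _ => ?_
    have := hx i
    have := hα i
    exact Real.rpow_le_rpow hc.le (by linarith) (by linarith)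
  have h0 : 0 ≤ ∏ i, c ^ (2 * α i + 1) := Finset.prod_nonneg fun i _ => by positivity
  have hr : 0 < r := hc.trans_le hcr
  rw [ballWeight]
  gcongr

/-- Size and smoothness of a kernel `∫ K_t(x,y) φ(t) dν(t)` from pointwise bounds in `t`. The
majorant `β(t, r)` decreases in `r = |x-y|` and its integral in `t` is `O(1/r)`, so that near a
point off the diagonal the integrand and its differential have a common integrable bound. -/
theorem kernel_estimates {X : Type*} [MeasurableSpace X] {ν : Measure X} {d : ℕ} {α : Fin d → ℝ}
    (hα : ∀ i, -(1 / 2) ≤ α i)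
    {K : X → EuclideanSpace ℝ (Fin d) × EuclideanSpace ℝ (Fin d) → ℝ}
    {K' : X → EuclideanSpace ℝ (Fin d) × EuclideanSpace ℝ (Fin d) →
      EuclideanSpace ℝ (Fin d) × EuclideanSpace ℝ (Fin d) →L[ℝ] ℝ}
    {φ : X → ℂ} {F : EuclideanSpace ℝ (Fin d) → EuclideanSpace ℝ (Fin d) → ℂ}
    {β : X → ℝ → ℝ} {D N : ℝ} (hD : 0 ≤ D)
    (hF : ∀ x ∈ orthant d, ∀ y ∈ orthant d, F x y = ∫ t, (K t (x, y) : ℂ) * φ t ∂ν)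
    (hφ : AEStronglyMeasurable φ ν)
    (hK : ∀ p, AEStronglyMeasurable (fun t => K t p) ν)
    (hK' : ∀ p, AEStronglyMeasurable (fun t => K' t p) ν)
    (hdiff : ∀ t p, HasFDerivAt (K t) (K' t p) p)
    (hβ : ∀ r, 0 < r → Integrable (fun t => β t r) ν)
    (hβ_int : ∀ r, 0 < r → ∫ t, β t r ∂ν ≤ N / r)
    (hβ_anti : ∀ᵐ t ∂ν, ∀ r s, 0 < r → r ≤ s → β t s ≤ β t r)
    (hbound : ∀ᵐ t ∂ν, ∀ x ∈ orthant d, ∀ y ∈ orthant d, x ≠ y →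
      |K t (x, y)| * ‖φ t‖ ≤ D / ballWeight α x ‖x - y‖ * (‖x - y‖ * β t ‖x - y‖) ∧
      ‖K' t (x, y)‖ * ‖φ t‖ ≤ D / ballWeight α x ‖x - y‖ * β t ‖x - y‖)
    {x y : EuclideanSpace ℝ (Fin d)} (hx : x ∈ orthant d) (hy : y ∈ orthant d) (hxy : x ≠ y) :
    Integrable (fun t => (K t (x, y) : ℂ) * φ t) ν ∧
    ‖F x y‖ ≤ D * N / ballWeight α x ‖x - y‖ ∧
    DifferentiableAt ℝ (Function.uncurry F) (x, y) ∧
    gradNorm F x y ≤ √(2 * d) * (D * N / (‖x - y‖ * ballWeight α x ‖x - y‖)) := by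
  have hr : 0 < ‖x - y‖ := norm_sub_pos_iff.2 hxy
  have hV := ballWeight_pos α hx hr
  have hmeas (p : EuclideanSpace ℝ (Fin d) × EuclideanSpace ℝ (Fin d)) :
      AEStronglyMeasurable (fun t => (K t p : ℂ) * φ t) ν :=
    (Complex.continuous_ofReal.comp_aestronglyMeasurable (hK p)).mul hφ
  have hnorm (t : X) (p : EuclideanSpace ℝ (Fin d) × EuclideanSpace ℝ (Fin d)) :
      ‖(K t p : ℂ) * φ t‖ = |K t p| * ‖φ t‖ := by rw [norm_mul, Complex.norm_real, Real.norm_eq_abs]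
  set L : X → EuclideanSpace ℝ (Fin d) × EuclideanSpace ℝ (Fin d) →
      EuclideanSpace ℝ (Fin d) × EuclideanSpace ℝ (Fin d) →L[ℝ] ℂ :=
    fun t p => (K' t p).smulRight (φ t) with hL
  have hLnorm (t : X) (p : EuclideanSpace ℝ (Fin d) × EuclideanSpace ℝ (Fin d)) :
      ‖L t p‖ = ‖K' t p‖ * ‖φ t‖ := ContinuousLinearMap.norm_smulRight_apply _ _
  have hint : Integrable (fun t => (K t (x, y) : ℂ) * φ t) ν := by
    refine Integrable.mono' (((hβ _ hr).const_mul ‖x - y‖).const_mul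
      (D / ballWeight α x ‖x - y‖)) (hmeas _) ?_
    filter_upwards [hbound] with t ht
    rw [hnorm]
    exact (ht x hx y hy hxy).1
  -- a neighbourhood of `(x, y)` on which `|x'-y'|` and the ball weight are bounded below
  set r₀ := ‖x - y‖ / 2 with hr₀
  have hr₀pos : 0 < r₀ := by positivity
  set v₀ := r₀ ^ d * ∏ i, r₀ ^ (2 * α i + 1)
  have hv₀ : 0 < v₀ := mul_pos (by positivity) (Finset.prod_pos fun i _ => by positivity)
  set U : Set (EuclideanSpace ℝ (Fin d) × EuclideanSpace ℝ (Fin d)) :=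
    (orthant d ×ˢ orthant d) ∩ {p | r₀ < ‖p.1 - p.2‖} with hU
  have hUopen : IsOpen U := ((isOpen_orthant d).prod (isOpen_orthant d)).inter
    (isOpen_lt continuous_const (by fun_prop))
  have hUmem : (x, y) ∈ U := ⟨⟨hx, hy⟩, by simp only [mem_ofPred_eq, hr₀]; linarith⟩
  have hder : HasFDerivAt (fun p => ∫ t, (K t p : ℂ) * φ t ∂ν) (∫ t, L t (x, y) ∂ν) (x, y) := by
    refine hasFDerivAt_integral_of_dominated_of_fderiv_le (F' := fun p t => L t p)
      (bound := fun t => D / v₀ * β t r₀) (hUopen.mem_nhds hUmem)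
      (Filter.Eventually.of_forall hmeas) hint ?_ ?_ ((hβ _ hr₀pos).const_mul _) ?_
    · exact (ContinuousLinearMap.smulRightL ℝ (EuclideanSpace ℝ (Fin d) × EuclideanSpace ℝ (Fin d))
        ℂ).aestronglyMeasurable_comp₂ (hK' _) hφ
    · filter_upwards [hbound, hβ_anti] with t ht hanti p hp
      have hp0 : 0 < ‖p.1 - p.2‖ := hr₀pos.trans hp.2
      have hV' := ballWeight_pos α hp.1.1 hp0
      have hb := (ht p.1 hp.1.1 p.2 hp.1.2 (norm_sub_pos_iff.1 hp0)).2
      have hβ0 : 0 ≤ D / ballWeight α p.1 ‖p.1 - p.2‖ * β t ‖p.1 - p.2‖ :=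
        (by positivity : 0 ≤ ‖K' t (p.1, p.2)‖ * ‖φ t‖).trans hb
      have hlow : v₀ ≤ ballWeight α p.1 ‖p.1 - p.2‖ :=
        le_ballWeight hα hp.1.1 hr₀pos (le_of_lt hp.2)
      rw [hLnorm]
      rcases hD.eq_or_lt with rfl | hD
      · simpa using hb
      have hβ1 : 0 ≤ β t ‖p.1 - p.2‖ := nonneg_of_mul_nonneg_right hβ0 (by positivity)
      calc _ ≤ D / ballWeight α p.1 ‖p.1 - p.2‖ * β t ‖p.1 - p.2‖ := hb
        _ ≤ D / v₀ * β t ‖p.1 - p.2‖ := by gcongr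
        _ ≤ D / v₀ * β t r₀ := by
            gcongr
            exact hanti _ _ hr₀pos (le_of_lt hp.2)
    · refine Filter.Eventually.of_forall fun t p _ => ?_
      have h := (Complex.ofRealCLM.hasFDerivAt.comp p (hdiff t p)).mul_const (φ t)
      refine h.congr_fderiv ?_
      ext <;> simp [hL, mul_comm]
  have hFder : HasFDerivAt (Function.uncurry F) (∫ t, L t (x, y) ∂ν) (x, y) := by
    refine hder.congr_of_eventuallyEq ?_
    filter_upwards [hUopen.mem_nhds hUmem] with p hp
    exact hF p.1 hp.1.1 p.2 hp.1.2
  refine ⟨hint, ?_, hFder.differentiableAt, gradNorm_le hFder ?_⟩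
  · rw [hF x hx y hy]
    calc _ ≤ ∫ t, D / ballWeight α x ‖x - y‖ * (‖x - y‖ * β t ‖x - y‖) ∂ν := by
          refine norm_integral_le_of_norm_le (((hβ _ hr).const_mul _).const_mul _) ?_
          filter_upwards [hbound] with t ht
          rw [hnorm]
          exact (ht x hx y hy hxy).1
      _ = D / ballWeight α x ‖x - y‖ * (‖x - y‖ * ∫ t, β t ‖x - y‖ ∂ν) := by
          rw [integral_const_mul, integral_const_mul]
      _ ≤ D / ballWeight α x ‖x - y‖ * (‖x - y‖ * (N / ‖x - y‖)) := by
          have := hβ_int _ hr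
          gcongr
      _ = _ := by field_simp
  · calc _ ≤ ∫ t, D / ballWeight α x ‖x - y‖ * β t ‖x - y‖ ∂ν := by
          refine norm_integral_le_of_norm_le ((hβ _ hr).const_mul _) ?_
          filter_upwards [hbound] with t ht
          rw [hLnorm]
          exact (ht x hx y hy hxy).2
      _ = D / ballWeight α x ‖x - y‖ * ∫ t, β t ‖x - y‖ ∂ν := integral_const_mul _ _
      _ ≤ D / ballWeight α x ‖x - y‖ * (N / ‖x - y‖) := by
          have := hβ_int _ hr
          gcongr
      _ = _ := by field_simp

end DunklLaguerre

end

theorem theorem2p5 (d : ℕ) (hd : 1 ≤ d) (α : Fin d → ℝ) (hα : ∀ i, -(1 / 2 : ℝ) ≤ α i)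
    (ε : Fin d → Fin 2) :
    (∃ C : ℝ, 0 < C ∧ ∀ (η : ℝ → ℂ) (M : ℝ),
      AEStronglyMeasurable η (volume.restrict (Ioi (0 : ℝ))) →
      (∀ t ∈ Ioi (0 : ℝ), ‖η t‖ ≤ M) →
      ∀ x ∈ DunklLaguerre.orthant d, ∀ y ∈ DunklLaguerre.orthant d, x ≠ y →
        IntegrableOn
          (fun t => ((deriv (fun s => DunklLaguerre.G α ε s x y) t : ℝ) : ℂ) * η t)
          (Ioi (0 : ℝ)) ∧
        ‖DunklLaguerre.laplaceKernel α ε η x y‖ ≤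
          C * M * (1 / (DunklLaguerre.wPlus α).real (Metric.ball x ‖y - x‖)) ∧
        DifferentiableAt ℝ
          (Function.uncurry (DunklLaguerre.laplaceKernel α ε η)) (x, y) ∧
        DunklLaguerre.gradNorm (DunklLaguerre.laplaceKernel α ε η) x y ≤
          C * M * (1 / ‖x - y‖ *
            (1 / (DunklLaguerre.wPlus α).real (Metric.ball x ‖y - x‖)))) ∧
    (∃ C : ℝ, 0 < C ∧ ∀ μ : DunklLaguerre.PolarMeasure,
      Integrable (fun t : Ioi (0 : ℝ) => Real.exp (-(t : ℝ) * DunklLaguerre.lambda0 α)) μ.abs →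
      ∀ x ∈ DunklLaguerre.orthant d, ∀ y ∈ DunklLaguerre.orthant d, x ≠ y →
        Integrable (fun t : Ioi (0 : ℝ) => DunklLaguerre.G α ε t x y) μ.abs ∧
        ‖DunklLaguerre.stieltjesKernel α ε μ x y‖ ≤
          C * (∫ t : Ioi (0 : ℝ), Real.exp (-(t : ℝ) * DunklLaguerre.lambda0 α) ∂μ.abs) *
            (1 / (DunklLaguerre.wPlus α).real (Metric.ball x ‖y - x‖)) ∧
        DifferentiableAt ℝ
          (Function.uncurry (DunklLaguerre.stieltjesKernel α ε μ)) (x, y) ∧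
        DunklLaguerre.gradNorm (DunklLaguerre.stieltjesKernel α ε μ) x y ≤
          C * (∫ t : Ioi (0 : ℝ), Real.exp (-(t : ℝ) * DunklLaguerre.lambda0 α) ∂μ.abs) *
            (1 / ‖x - y‖ *
              (1 / (DunklLaguerre.wPlus α).real (Metric.ball x ‖y - x‖)))) := by
  open DunklLaguerre in
  choose θ θ₁ θ₂ hθ hθG using fun i => exists_isSymbol_pow_mul_besselI (hα i) (ε i)
  obtain ⟨C₁, hC₁, hker⟩ := exists_prodKernel_family_le hα hθ
  obtain ⟨C₂, hC₂, hmaj⟩ := exists_prod_majorant_le hd hα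
  obtain ⟨C₃, hC₃, hball⟩ := exists_wPlus_ball_le hd hα
  have hG {t : ℝ} (ht : 0 < t) {x y : EuclideanSpace ℝ (Fin d)} (hx : x ∈ orthant d)
      (hy : y ∈ orthant d) : G α ε t x y = prodKernel α θ t (x, y) :=
    G_eq_prodKernel hθG ht hx hy
  have hGderiv {t : ℝ} (ht : 0 < t) {x y : EuclideanSpace ℝ (Fin d)} (hx : x ∈ orthant d)
      (hy : y ∈ orthant d) : deriv (fun s => G α ε s x y) t = prodKernelT α θ θ₁ t (x, y) := by
    refine ((hasDerivAt_prodKernel hθ ht (x, y)).congr_of_eventuallyEq ?_).deriv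
    filter_upwards [Ioi_mem_nhds ht] with s hs
    exact hG hs hx hy
  -- replacing the ball weight by the measure of the ball
  have hconv {N : ℝ} (hN : 0 ≤ N) {κ : ℝ} (hκ0 : 0 ≤ κ) (hκ : κ ≤ 1 + √(2 * d)) {q : ℝ}
      (hq : 0 ≤ q) {x y : EuclideanSpace ℝ (Fin d)} (hx : x ∈ orthant d) (hxy : x ≠ y) :
      κ * (C₁ * C₂ * N * q / ballWeight α x ‖x - y‖) ≤ (1 + √(2 * d)) * (C₁ * C₂ * C₃) * N *
        (q * (1 / (wPlus α).real (Metric.ball x ‖y - x‖))) := by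
    have hr : 0 < ‖x - y‖ := norm_sub_pos_iff.2 hxy
    obtain ⟨hw, hwle⟩ := hball x hx _ hr
    have hV := ballWeight_pos α hx hr
    rw [norm_sub_rev y x]
    have h1 : 1 / ballWeight α x ‖x - y‖ ≤ C₃ * (1 / (wPlus α).real (Metric.ball x ‖x - y‖)) := by
      rw [mul_one_div, div_le_div_iff₀ hV hw, one_mul]
      exact hwle
    calc _ = κ * (C₁ * C₂ * N * q) * (1 / ballWeight α x ‖x - y‖) := by ring
      _ ≤ (1 + √(2 * d)) * (C₁ * C₂ * N * q) *
          (C₃ * (1 / (wPlus α).real (Metric.ball x ‖x - y‖))) := by gcongr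
      _ = _ := by ring
  refine ⟨⟨2 * ((1 + √(2 * d)) * (C₁ * C₂ * C₃)), by positivity, ?_⟩,
    ⟨(1 + √(2 * d)) * (C₁ * C₂ * C₃), by positivity, ?_⟩⟩
  · intro η M hη hηM x hx y hy hxy
    have hM : 0 ≤ M := (norm_nonneg _).trans (hηM 1 (mem_Ioi.2 one_pos))
    obtain ⟨h1, h2, h3, h4⟩ := kernel_estimates (ν := volume.restrict (Ioi (0 : ℝ))) hα
      (K := fun t p => prodKernelT α θ θ₁ t p) (K' := fun t p => prodKernelTD α θ θ₁ θ₂ t p)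
      (φ := fun t => -η t) (F := laplaceKernel α ε η)
      (β := fun t r => M * (t + r ^ 2) ^ (-(3 / 2 : ℝ))) (D := C₁ * C₂) (N := 2 * M)
      (by positivity)
      (fun x hx y hy => by
        rw [laplaceKernel, ← integral_neg]
        refine setIntegral_congr_fun measurableSet_Ioi fun t ht => ?_
        rw [hGderiv ht hx hy, mul_neg])
      hη.neg
      (fun p => (continuousOn_prodKernel_family hθ p).2.1.aestronglyMeasurable measurableSet_Ioi)
      (fun p => (continuousOn_prodKernel_family hθ p).2.2.2.aestronglyMeasurable measurableSet_Ioi)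
      (fun t p => hasFDerivAt_prodKernelT hθ t p)
      (fun r hr => (integrableOn_add_sq_rpow hr).const_mul M)
      (fun r hr => by
        rw [integral_const_mul, integral_add_sq_rpow hr]
        exact le_of_eq (by ring))
      ((ae_restrict_iff' measurableSet_Ioi).2 <| Filter.Eventually.of_forall
        fun t ht r s hr hrs => by
          have ht0 : (0 : ℝ) < t := ht
          refine mul_le_mul_of_nonneg_left ?_ hM
          exact Real.rpow_le_rpow_of_nonpos (by positivity) (by gcongr) (by norm_num))
      ((ae_restrict_iff' measurableSet_Ioi).2 <| Filter.Eventually.of_forall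
        fun t ht x hx y hy hxy => by
          have ht0 : (0 : ℝ) < t := ht
          obtain ⟨-, k1, -, k2⟩ := hker t ht (x, y) hx hy
          obtain ⟨-, -, m1, m2⟩ := hmaj t ht x hx y hy hxy
          rw [norm_neg]
          constructor
          · calc _ ≤ C₁ * (C₂ / ballWeight α x ‖x - y‖ *
                  (‖x - y‖ * (t + ‖x - y‖ ^ 2) ^ (-(3 / 2 : ℝ)))) * M :=
                  mul_le_mul (k1.trans (by gcongr)) (hηM t ht) (norm_nonneg _)
                    ((abs_nonneg _).trans (k1.trans (by gcongr)))
              _ = _ := by ring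
          · calc _ ≤ C₁ * (C₂ / ballWeight α x ‖x - y‖ *
                  (t + ‖x - y‖ ^ 2) ^ (-(3 / 2 : ℝ))) * M :=
                  mul_le_mul (k2.trans (by gcongr)) (hηM t ht) (norm_nonneg _)
                    ((norm_nonneg _).trans (k2.trans (by gcongr)))
              _ = _ := by ring)
      hx hy hxy
    refine ⟨?_, h2.trans ?_, h3, h4.trans ?_⟩
    · refine (IntegrableOn.congr_fun (f := fun t => -((prodKernelT α θ θ₁ t (x, y) : ℂ) * -η t))
        h1.neg (fun t ht => ?_) measurableSet_Ioi)
      rw [hGderiv ht hx hy]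
      ring
    · have := hconv (N := 2 * M) (by positivity) zero_le_one (by simp) zero_le_one hx hxy
      rw [one_mul, one_mul, mul_one] at this
      exact this.trans_eq (by ring)
    · have := hconv (N := 2 * M) (by positivity) (Real.sqrt_nonneg (2 * d)) (by simp)
        (q := 1 / ‖x - y‖) (by positivity) hx hxy
      refine le_trans (le_of_eq ?_) (this.trans_eq (by ring))
      rw [mul_one_div, div_div]
  · intro μ hμ x hx y hy hxy
    have hN : 0 ≤ ∫ t : Ioi (0 : ℝ), Real.exp (-(t : ℝ) * lambda0 α) ∂μ.abs :=
      integral_nonneg fun t => (Real.exp_pos _).le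
    have hcont {V : Type} [NormedAddCommGroup V] [SecondCountableTopology V] {f : ℝ → V}
        (hf : ContinuousOn f (Ioi 0)) :
        AEStronglyMeasurable (fun t : Ioi (0 : ℝ) => f t) μ.abs :=
      (continuousOn_iff_continuous_domRestrict.1 hf).aestronglyMeasurable
    obtain ⟨h1, h2, h3, h4⟩ := kernel_estimates (ν := μ.abs) hα
      (K := fun t p => prodKernel α θ t p) (K' := fun t p => prodKernelD α θ θ₁ t p)
      (φ := μ.phase) (F := stieltjesKernel α ε μ)
      (β := fun t r => Real.exp (-(t : ℝ) * lambda0 α) / r) (D := C₁ * C₂)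
      (N := ∫ t : Ioi (0 : ℝ), Real.exp (-(t : ℝ) * lambda0 α) ∂μ.abs)
      (by positivity)
      (fun x hx y hy => by
        rw [stieltjesKernel, PolarMeasure.integral]
        refine integral_congr_ae (Filter.Eventually.of_forall fun t => ?_)
        simp only [hG t.2 hx hy])
      μ.measurable_phase.aestronglyMeasurable
      (fun p => hcont (continuousOn_prodKernel_family hθ p).1)
      (fun p => hcont (continuousOn_prodKernel_family hθ p).2.2.1)
      (fun t p => hasFDerivAt_prodKernel hθ t p)
      (fun r _ => hμ.div_const r)
      (fun r _ => by rw [integral_div])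
      (Filter.Eventually.of_forall fun t r s hr hrs => by gcongr)
      (μ.norm_phase.mono fun t hφ x hx y hy hxy => by
        have hr : 0 < ‖x - y‖ := norm_sub_pos_iff.2 hxy
        have hV := ballWeight_pos α hx hr
        obtain ⟨k1, -, k2, -⟩ := hker t t.2 (x, y) hx hy
        obtain ⟨m1, m2, -, -⟩ := hmaj t t.2 x hx y hy hxy
        rw [hφ, mul_one, mul_one]
        have hexp : Real.exp (-(t : ℝ) * lambda0 α) * Real.exp ((t : ℝ) * lambda0 α) = 1 := by
          rw [← Real.exp_add]
          simp
        have conv {a b : ℝ} (h : Real.exp ((t : ℝ) * lambda0 α) * a ≤ b) :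
            a ≤ Real.exp (-(t : ℝ) * lambda0 α) * b := by
          calc a = Real.exp (-(t : ℝ) * lambda0 α) * (Real.exp ((t : ℝ) * lambda0 α) * a) := by
                rw [← mul_assoc, hexp, one_mul]
            _ ≤ _ := by gcongr
        refine ⟨k1.trans ((mul_le_mul_of_nonneg_left (conv m1) hC₁.le).trans_eq ?_),
          k2.trans ((mul_le_mul_of_nonneg_left (conv m2) hC₁.le).trans_eq ?_)⟩
        · field_simp
        · field_simp)
      hx hy hxy
    refine ⟨?_, h2.trans ?_, h3, h4.trans ?_⟩
    · refine (integrable_norm_iff ?_).1 (h1.norm.congr ?_)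
      · refine (hcont (continuousOn_prodKernel_family hθ (x, y)).1).congr
          (Filter.Eventually.of_forall fun t => (hG t.2 hx hy).symm)
      · filter_upwards [μ.norm_phase] with t ht
        rw [norm_mul, ht, mul_one, Complex.norm_real, hG t.2 hx hy]
    · have := hconv hN zero_le_one (by simp) zero_le_one hx hxy
      rw [one_mul, one_mul, mul_one] at this
      exact this
    · have := hconv hN (Real.sqrt_nonneg (2 * d)) (by simp)
        (q := 1 / ‖x - y‖) (by positivity) hx hxy
      refine le_trans (le_of_eq ?_) this
      rw [mul_one_div, div_div]
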